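/- A \emph{Steiner triple system} of order $v$ is a pair $(X,\mathcal B)$ where $X$ is a set of $v$ points and $\mathcal B$ is a collection of $3$-element subsets of $X$ (blocks) such that every pair of distinct points of $X$ is contained in exactly one block. It is \emph{resolvable}, and is then called a \emph{Kirkman triple system} of order $v$, if $\mathcal B$ can be partitioned into parallel classes, i.e. into subcollections each of which is a partition of $X$. A \emph{large set of Kirkman triple systems} of order $v$, denoted $\mathrm{LKTS}(v)$, is a set of $v-2$ Kirkman triple systems of order $v$ on the same point set, no two of which have a block in common. \textbf{Corollary.} For every $q\in\{7,13,19,25,31,37,43,49,61\}$ and every integer $n\ge 1$, there exists an $\mathrm{LKTS}(q^n+2)$. -/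

import Mathlib

/-- `B` is the block set of a Steiner triple system on the point set `X`: every block is a triple,
and every pair of distinct points lies in exactly one block. -/
structure IsSteinerTripleSystem {X : Type*} (B : Finset (Finset X)) : Prop where
  card_block : ∀ b ∈ B, b.card = 3
  pair_unique : ∀ x y : X, x ≠ y → ∃! b : Finset X, b ∈ B ∧ x ∈ b ∧ y ∈ b

/-- `P` is a parallel class on `X`: its blocks partition the point set
(they are nonempty and every point lies in exactly one of them). -/
def IsParallelClass {X : Type*} (P : Finset (Finset X)) : Prop :=
  (∀ b ∈ P, b.Nonempty) ∧ ∀ x : X, ∃! b : Finset X, b ∈ P ∧ x ∈ b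

/-- `B` is resolvable: it can be partitioned into parallel classes.
(When `B` is a Steiner triple system on `v ≥ 3` points, the number of classes is automatically
`(v - 1) / 2`, since each class has exactly one of the `(v - 1) / 2` blocks through a given
point.) -/
def IsResolvable {X : Type*} [DecidableEq X] (B : Finset (Finset X)) : Prop :=
  ∃ A : Finpartition B, ∀ P ∈ A.parts, IsParallelClass P

/-- `B` is the block set of a Kirkman triple system: a resolvable Steiner triple system. -/
structure IsKirkmanTripleSystem {X : Type*} [DecidableEq X] (B : Finset (Finset X)) : Prop where
  steiner : IsSteinerTripleSystem B
  resolvable : IsResolvable B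

/-- `S` is a large set of Kirkman triple systems on the `v`-point set `X`: a set of exactly
`v - 2` Kirkman triple systems on `X`, no two of which have a triple in common. -/
structure IsLargeSetKTS {X : Type*} [Fintype X] [DecidableEq X]
    (S : Finset (Finset (Finset X))) : Prop where
  kirkman : ∀ D ∈ S, IsKirkmanTripleSystem D
  pairwise_disjoint : ∀ D ∈ S, ∀ E ∈ S, D ≠ E → Disjoint D E
  card_add_two : S.card + 2 = Fintype.card X

/-- There exists an LKTS(`v`), a large set of Kirkman triple systems of order `v`. -/
def ExistsLKTS (v : ℕ) : Prop :=
  ∃ (X : Type) (_ : Fintype X) (_ : DecidableEq X),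
    Fintype.card X = v ∧ ∃ S : Finset (Finset (Finset X)), IsLargeSetKTS S

/-!
# Large sets of Kirkman triple systems of order `q ^ n + 2`

The large sets consist of the translates of one Kirkman triple system on `V ∪ {∞, ∞'}`, where
`V = F ^ n` and `F` is the field of order `q ≡ 1 (mod 6)`. The translates of a system are pairwise
disjoint as soon as no nonzero translation carries a block onto a block (`IsRigidKTS`,
`IsRigidKTS.existsLKTS`).

Such a system on `V` is built from one on `F`, containing the block `{0, ∞, ∞'}`
(`IsRigidKTS.extend`). Each line through the origin, with the infinite points, receives a copy of
the system on `F`; these copies share only the block `{0, ∞, ∞'}`, and they cover the pairs of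
points that are collinear with the origin. A pair `x, y` of independent vectors is covered by
`{x, y, -x - y}`. A zero-sum triple of `V` cannot be translated to another one because `3` is
invertible, and it cannot be translated into a line.

The classes of the copies that contain `{0, ∞, ∞'}` combine to one parallel class. Each of the
other `(q - 1) / 2` classes on a line `L` has to be completed by a partition of `V \ L` into
zero-sum triples, so the zero-sum triples must form a Kirkman frame. Let `ω` be a primitive cube
root of unity. A zero-sum triple is `{p + v, ω p + ω² v, ω² p + ω v}`, and the pair `(p, v)` is unique up to
exchanging `p` and `v` and multiplying them by inverse cube roots of unity. Fix a nonzero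
alternating form on each plane through the origin; this gives a function `d` of two vectors, whose
value `d p v` is determined by the triple up to sign. Let `H` contain one element of each pair
`{c, -c}` of nonzero scalars. Then each triple has exactly one presentation, up to cube roots of
unity, with `d p v ∈ H`, and it is assigned to the line of `p` and the number `c = d p v`
(`frameClass`). The triple of `L` and `c` through a vector `w` off `L` is unique, since
`d p (w - p) = d p w` and `p` is determined by this value on `L`
(`existsUnique_mem_frameClass`). There are `|H| = (q - 1) / 2` classes for each line, as required.

It remains to give systems on `F` for `q = 7, 13, 19, 25, 31, 37, 43, 61`; powers of `49` are powers
of `7`. They are listed explicitly, and the kernel evaluates a test (`isRigidKTSCode`) whose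
soundness is `isRigidKTS_of_code`.
-/

/-! ### Resolved triple systems and rigidity under translations -/

/-- A resolved Steiner triple system on `X`: the sets `R i` are its parallel classes, indexed by
`i : ι`. Classes are sets of blocks, which keeps the constructions free of decidability
conditions. -/
structure IsResolvedSTS {X ι : Type*} (R : ι → Set (Finset X)) : Prop where
  card_block : ∀ ⦃i b⦄, b ∈ R i → b.card = 3
  parallel : ∀ i x, ∃! b, b ∈ R i ∧ x ∈ b
  pair : ∀ x y, x ≠ y → ∃! b, (∃ i, b ∈ R i) ∧ x ∈ b ∧ y ∈ b
  disjoint : ∀ ⦃i j b⦄, b ∈ R i → b ∈ R j → i = j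

namespace IsResolvedSTS

variable {X Y ι κ : Type*} {R : ι → Set (Finset X)}

theorem reindex (h : IsResolvedSTS R) (e : κ ≃ ι) : IsResolvedSTS (R ∘ e) where
  card_block _ _ hb := h.card_block hb
  parallel i x := h.parallel (e i) x
  pair x y hxy := by
    obtain ⟨b, ⟨⟨i, hi⟩, hx⟩, hu⟩ := h.pair x y hxy
    refine ⟨b, ⟨⟨e.symm i, by simpa using hi⟩, hx⟩, ?_⟩
    rintro b' ⟨⟨j, hj⟩, hx'⟩
    exact hu b' ⟨⟨e j, hj⟩, hx'⟩
  disjoint i j b hi hj := e.injective (h.disjoint hi hj)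

/-- Two points lie in at most one block. -/
theorem block_unique (h : IsResolvedSTS R) {i j : ι} {b b' : Finset X} {x y : X} (hxy : x ≠ y)
    (hb : b ∈ R i) (hb' : b' ∈ R j) (hx : x ∈ b) (hy : y ∈ b) (hx' : x ∈ b') (hy' : y ∈ b') :
    b = b' :=
  (h.pair x y hxy).unique ⟨⟨i, hb⟩, hx, hy⟩ ⟨⟨j, hb'⟩, hx', hy'⟩

theorem map (h : IsResolvedSTS R) (e : X ≃ Y) :
    IsResolvedSTS fun i => Finset.map e.toEmbedding '' R i where
  card_block := by
    rintro i _ ⟨b, hb, rfl⟩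
    simpa using h.card_block hb
  parallel i y := by
    obtain ⟨b, ⟨hb, hy⟩, hu⟩ := h.parallel i (e.symm y)
    refine ⟨b.map e.toEmbedding, ⟨⟨b, hb, rfl⟩, by simpa [Finset.mem_map_equiv] using hy⟩, ?_⟩
    rintro _ ⟨⟨c, hc, rfl⟩, hy'⟩
    rw [hu c ⟨hc, by simpa [Finset.mem_map_equiv] using hy'⟩]
  pair y y' hyy' := by
    obtain ⟨b, ⟨⟨i, hb⟩, hy, hy'⟩, hu⟩ := h.pair (e.symm y) (e.symm y') (by simpa using hyy')
    refine ⟨b.map e.toEmbedding, ⟨⟨i, b, hb, rfl⟩, by simpa [Finset.mem_map_equiv] using hy,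
      by simpa [Finset.mem_map_equiv] using hy'⟩, ?_⟩
    rintro _ ⟨⟨j, c, hc, rfl⟩, hz, hz'⟩
    rw [hu c ⟨⟨j, hc⟩, by simpa [Finset.mem_map_equiv] using hz,
      by simpa [Finset.mem_map_equiv] using hz'⟩]
  disjoint := by
    rintro i j _ ⟨b, hb, rfl⟩ ⟨c, hc, hcb⟩
    rw [Finset.map_injective _ hcb] at hc
    exact h.disjoint hb hc

theorem isKirkmanTripleSystem [DecidableEq X] (h : IsResolvedSTS R)
    (D : Finset (Finset X)) (hD : ∀ b, b ∈ D ↔ ∃ i, b ∈ R i) : IsKirkmanTripleSystem D where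
  steiner :=
    { card_block := fun b hb => by
        obtain ⟨i, hi⟩ := (hD b).1 hb
        exact h.card_block hi
      pair_unique := fun x y hxy => by simpa only [hD] using h.pair x y hxy }
  resolvable := by
    classical
    -- the classes as subfamilies of `D`
    let C : ι → Finset (Finset X) := fun i => D.filter (· ∈ R i)
    have hC : ∀ i b, b ∈ C i ↔ b ∈ R i := fun i b => by
      simp only [C, Finset.mem_filter, and_iff_right_iff_imp]
      exact fun hb => (hD b).2 ⟨i, hb⟩
    let parts : Finset (Finset (Finset X)) := D.powerset.filter (· ∈ Set.range C)
    have hne : ∀ b i, b ∈ R i → b.Nonempty := fun b i hb =>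
      Finset.card_pos.1 (by rw [h.card_block hb]; norm_num)
    by_cases hX : Nonempty X
    · refine ⟨Finpartition.ofExistsUnique parts ?_ ?_ ?_, ?_⟩
      · intro p hp
        exact Finset.mem_powerset.1 (Finset.mem_filter.1 hp).1
      · intro b hb
        obtain ⟨i, hi⟩ := (hD b).1 hb
        refine ⟨C i, ⟨?_, (hC i b).2 hi⟩, ?_⟩
        · exact Finset.mem_filter.2 ⟨Finset.mem_powerset.2 (Finset.filter_subset _ _), i, rfl⟩
        · rintro p ⟨hp, hbp⟩
          obtain ⟨j, rfl⟩ := (Finset.mem_filter.1 hp).2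
          rw [h.disjoint ((hC j b).1 hbp) hi]
      · intro hp
        obtain ⟨j, hj⟩ := (Finset.mem_filter.1 hp).2
        obtain ⟨b, ⟨hb, -⟩, -⟩ := h.parallel j hX.some
        have := (hC j b).2 hb
        rw [hj] at this
        simp at this
      · intro p hp
        obtain ⟨j, rfl⟩ := (Finset.mem_filter.1 hp).2
        refine ⟨fun b hb => hne b j ((hC j b).1 hb), fun x => ?_⟩
        simpa only [hC] using h.parallel j x
    · -- without points there are no blocks, and the empty partition will do
      have hD0 : D = ∅ := by
        refine Finset.eq_empty_of_forall_notMem fun b hb => ?_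
        obtain ⟨i, hi⟩ := (hD b).1 hb
        exact hX ⟨(hne b i hi).choose⟩
      subst hD0
      exact ⟨Finpartition.empty _, fun P hP => absurd hP (by simp)⟩

end IsResolvedSTS

/-- The translation of `G ∪ {∞, ∞'}` by `t`, fixing both infinite points. The infinite points are
`Sum.inr false` and `Sum.inr true`. -/
def shift {G : Type*} [AddGroup G] (t : G) : G ⊕ Bool ≃ G ⊕ Bool :=
  Equiv.sumCongr (Equiv.addRight t) (Equiv.refl Bool)

section shift

variable {G : Type*} [AddGroup G]

@[simp] theorem shift_inl (t x : G) : shift t (Sum.inl x) = Sum.inl (x + t) := rfl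

@[simp] theorem shift_inr (t : G) (c : Bool) : shift t (Sum.inr c) = Sum.inr c := rfl

@[simp] theorem shift_symm_inl (t x : G) : (shift t).symm (Sum.inl x) = Sum.inl (x - t) := by
  rw [Equiv.symm_apply_eq]; simp

@[simp] theorem shift_symm_inr (t : G) (c : Bool) : (shift t).symm (Sum.inr c) = Sum.inr c := rfl

end shift

/-- A resolved Steiner triple system on `G ∪ {∞, ∞'}` is translation-rigid if no nonzero
translation carries a block onto a block. Its `|G|` translates are then pairwise disjoint. -/
structure IsRigidKTS {G ι : Type*} [AddCommGroup G] (R : ι → Set (Finset (G ⊕ Bool))) : Prop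
    extends IsResolvedSTS R where
  rigid : ∀ ⦃i j b b' t⦄, b ∈ R i → b' ∈ R j → (∀ p ∈ b, shift t p ∈ b') → t = 0

theorem IsRigidKTS.reindex {G ι κ : Type*} [AddCommGroup G] {R : ι → Set (Finset (G ⊕ Bool))}
    (h : IsRigidKTS R) (e : κ ≃ ι) : IsRigidKTS (R ∘ e) :=
  { h.toIsResolvedSTS.reindex e with
    rigid := fun _ _ _ _ _ hb hb' ht => h.rigid hb hb' ht }

/-- The translates of a translation-rigid Kirkman triple system form a large set. -/
theorem IsRigidKTS.existsLKTS {G ι : Type} [AddCommGroup G] [Fintype G]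
    {R : ι → Set (Finset (G ⊕ Bool))} (h : IsRigidKTS R) : ExistsLKTS (Fintype.card G + 2) := by
  classical
  let T : G → ι → Set (Finset (G ⊕ Bool)) :=
    fun a i => Finset.map (shift a).toEmbedding '' R i
  let D : G → Finset (Finset (G ⊕ Bool)) := fun a => Finset.univ.filter fun b => ∃ i, b ∈ T a i
  have hD : ∀ a b, b ∈ D a ↔ ∃ i, b ∈ T a i := by simp [D]
  have hK : ∀ a, IsKirkmanTripleSystem (D a) := fun a =>
    (h.toIsResolvedSTS.map (shift a)).isKirkmanTripleSystem (D a) (hD a)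
  have key : ∀ a a' b, b ∈ D a → b ∈ D a' → a = a' := by
    intro a a' b hb hb'
    obtain ⟨i, c, hc, rfl⟩ := (hD a b).1 hb
    obtain ⟨j, c', hc', hcc⟩ := (hD a' _).1 hb'
    refine sub_eq_zero.1 (h.rigid (t := a - a') hc hc' fun p hp => ?_)
    have hp' : shift a p ∈ c'.map (shift a').toEmbedding := by
      rw [hcc]; exact Finset.mem_map_of_mem _ hp
    rw [Finset.mem_map_equiv] at hp'
    rcases p with x | c
    · simpa [add_sub_assoc] using hp'
    · simpa using hp'
  have hinj : Function.Injective D := by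
    intro a a' haa
    obtain ⟨b, ⟨hb, -⟩, -⟩ :=
      (hK a).steiner.pair_unique (Sum.inr false) (Sum.inr true) (by simp)
    exact key a a' b hb (haa ▸ hb)
  refine ⟨G ⊕ Bool, inferInstance, inferInstance, by simp, Finset.univ.image D, ?_, ?_, ?_⟩
  · intro E hE
    obtain ⟨a, -, rfl⟩ := Finset.mem_image.1 hE
    exact hK a
  · intro E hE E' hE' hne
    obtain ⟨a, -, rfl⟩ := Finset.mem_image.1 hE
    obtain ⟨a', -, rfl⟩ := Finset.mem_image.1 hE'
    rw [Finset.disjoint_left]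
    exact fun b hb hb' => hne (by rw [key a a' b hb hb'])
  · rw [Finset.card_image_of_injective _ hinj]
    simp

/-! ### Normalised vectors and area forms -/

/-- A degree-one homogeneous function vanishing only at the origin. Each line through the origin
contains exactly one vector on which it takes the value `1`. -/
structure IsNormalizer {F V : Type*} [Field F] [AddCommGroup V] [Module F V] (h : V → F) :
    Prop where
  smul : ∀ (t : F) (w : V), h (t • w) = t * h w
  ne_zero : ∀ ⦃w : V⦄, w ≠ 0 → h w ≠ 0

/-- A function that restricts to a nonzero alternating bilinear form on each plane through the
origin; no linearity is required across different planes. -/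
structure IsAreaForm {F V : Type*} [Field F] [AddCommGroup V] [Module F V] (d : V → V → F) :
    Prop where
  comb : ∀ (a b c e : F) (u v : V),
    d (a • u + b • v) (c • u + e • v) = (a * e - b * c) * d u v
  exists_smul : ∀ ⦃u v : V⦄, d u v = 0 → u ≠ 0 → ∃ t : F, v = t • u

/-- The first nonzero coordinate, for an arbitrary choice of one element in each nonempty set of
indices, is a normalizer. -/
theorem exists_isNormalizer (F I : Type*) [Field F] [Finite I] :
    ∃ h : (I → F) → F, IsNormalizer h := by
  classical
  have hσ : ∀ S : Set I, ∃ f : (I → F) → F,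
      (∀ t w, f (t • w) = t * f w) ∧ (S.Nonempty → ∃ i ∈ S, ∀ w, f w = w i) := by
    intro S
    by_cases hS : S.Nonempty
    · exact ⟨fun w => w hS.some, fun t w => by simp, fun _ => ⟨_, hS.some_mem, fun w => rfl⟩⟩
    · exact ⟨fun _ => 0, fun t w => by simp, fun h => absurd h hS⟩
  choose f hf hf' using hσ
  refine ⟨fun w => f (Function.support w) w, fun t w => ?_, fun w hw => ?_⟩
  · by_cases ht : t = 0
    · subst ht
      have := hf (Function.support (0 : I → F)) 0 0
      simpa using this
    · have : Function.support (t • w) = Function.support w := by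
        ext i; simp [ht]
      rw [this, hf]
  · obtain ⟨i, hi, hfi⟩ := hf' (Function.support w) (Function.support_nonempty_iff.2 hw)
    rw [hfi]
    exact Function.mem_support.1 hi

/-- Normalise the vector of `2 × 2` minors (the Plücker coordinates of the plane). -/
theorem exists_isAreaForm (F I : Type*) [Field F] [Finite I] :
    ∃ d : (I → F) → (I → F) → F, IsAreaForm d := by
  obtain ⟨h, hh⟩ := exists_isNormalizer F (I × I)
  refine ⟨fun u v => h fun p => u p.1 * v p.2 - u p.2 * v p.1, fun a b c e u v => ?_,
    fun u v huv hu => ?_⟩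
  · rw [← hh.smul]
    congr 1
    ext p
    simp only [Pi.add_apply, Pi.smul_apply, smul_eq_mul]
    ring
  · have h0 : (fun p : I × I => u p.1 * v p.2 - u p.2 * v p.1) = 0 := by
      by_contra hne
      exact hh.ne_zero hne huv
    obtain ⟨i, hi⟩ := Function.ne_iff.1 hu
    simp only [Pi.zero_apply] at hi
    refine ⟨v i / u i, funext fun j => ?_⟩
    have hij := congrFun h0 (i, j)
    simp only [Pi.zero_apply] at hij
    simp only [Pi.smul_apply, smul_eq_mul]
    field_simp
    linear_combination hij

section Extension

variable {F V : Type*} [Field F] [AddCommGroup V] [Module F V] {h : V → F} {d : V → V → F}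
  {ω : F}

theorem IsNormalizer.map_zero (hh : IsNormalizer h) : h 0 = 0 := by
  simpa using hh.smul 0 0

theorem IsNormalizer.exists_eq_smul (hh : IsNormalizer h) {w : V} (hw : w ≠ 0) :
    ∃ u : {u : V // h u = 1}, w = h w • u.1 :=
  ⟨⟨(h w)⁻¹ • w, by rw [hh.smul, inv_mul_cancel₀ (hh.ne_zero hw)]⟩,
    by rw [smul_smul, mul_inv_cancel₀ (hh.ne_zero hw), one_smul]⟩

theorem IsNormalizer.ne_zero_of_eq_one (hh : IsNormalizer h) (u : {u : V // h u = 1}) :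
    u.1 ≠ 0 := by
  intro hu
  have := u.2
  rw [hu, hh.map_zero] at this
  exact zero_ne_one this

theorem IsNormalizer.smul_eq_smul (hh : IsNormalizer h) {u u' : {u : V // h u = 1}} {s t : F}
    (hst : s • u.1 = t • u'.1) : s = t ∧ (s ≠ 0 → u = u') := by
  have h1 : s = t := by simpa [hh.smul, u.2, u'.2] using congrArg h hst
  subst h1
  exact ⟨rfl, fun hs => Subtype.ext (smul_right_injective V hs hst)⟩

namespace IsAreaForm

theorem smul_left (hd : IsAreaForm d) (s : F) (u v : V) : d (s • u) v = s * d u v := by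
  simpa using hd.comb s 0 0 1 u v

theorem self (hd : IsAreaForm d) (u : V) : d u u = 0 := by
  simpa using hd.comb 1 0 1 0 u 0

theorem smul_smul (hd : IsAreaForm d) (s t : F) (u : V) : d (s • u) (t • u) = 0 := by
  simpa using hd.comb s 0 t 0 u 0

theorem sub_left (hd : IsAreaForm d) (u v : V) : d (v - u) v = -d u v := by
  have := hd.comb (-1) 1 0 1 u v
  simpa [neg_add_eq_sub] using this

theorem sub_right (hd : IsAreaForm d) (u v : V) : d u (v - u) = d u v := by
  have := hd.comb 1 0 (-1) 1 u v
  simpa [neg_add_eq_sub] using this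

theorem swap (hd : IsAreaForm d) (u v : V) : d v u = -d u v := by
  simpa using hd.comb 0 1 1 0 u v

theorem ne_zero_left (hd : IsAreaForm d) {u v : V} (huv : d u v ≠ 0) : u ≠ 0 := by
  rintro rfl
  exact huv (by simpa using hd.smul_left 0 0 v)

end IsAreaForm

/-! ### The frame of zero-sum triples -/

/-- The zero-sum triple with Fourier coefficients `p` and `v` with respect to the cube root of
unity `ω`. -/
def zeroSumTriple [DecidableEq V] (ω : F) (p v : V) : Finset V :=
  {p + v, ω • p + ω ^ 2 • v, ω ^ 2 • p + ω • v}

/-- The holey parallel class missing the line through `u`: the zero-sum triples having one Fourier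
coefficient on that line and area `c`. -/
def frameClass [DecidableEq V] (d : V → V → F) (ω : F) (u : V) (c : F) : Set (Finset V) :=
  {T | ∃ (s : F) (v : V), d (s • u) v = c ∧ T = zeroSumTriple ω (s • u) v}

variable [DecidableEq V]

theorem zeroSumTriple_swap (p v : V) : zeroSumTriple ω v p = zeroSumTriple ω p v := by
  ext x
  simp only [zeroSumTriple, Finset.mem_insert, Finset.mem_singleton, add_comm v, add_comm (_ • v)]
  tauto

theorem zeroSumTriple_rotate (hω : ω ^ 2 + ω + 1 = 0) (p v : V) :
    zeroSumTriple ω (ω • p) (ω ^ 2 • v) = zeroSumTriple ω p v := by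
  have h3 : ω ^ 3 = 1 := by linear_combination (ω - 1) * hω
  have h4 : ω ^ 4 = ω := by linear_combination ω * h3
  ext x
  simp only [zeroSumTriple, Finset.mem_insert, Finset.mem_singleton, smul_smul]
  rw [show ω * ω = ω ^ 2 by ring, show ω ^ 2 * ω ^ 2 = ω by linear_combination h4,
    show ω ^ 2 * ω = 1 by linear_combination h3,
    show ω * ω ^ 2 = 1 by linear_combination h3]
  simp only [one_smul]
  tauto

theorem omega_sq_sub_ne_zero (hω : ω ^ 2 + ω + 1 = 0) (h3 : (3 : F) ≠ 0) : ω ^ 2 - ω ≠ 0 := by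
  intro hc
  apply h3
  linear_combination (ω ^ 2 - 3 * ω + 3) * hω - (ω ^ 2 - ω) * hc

theorem exists_eq_zeroSumTriple_sub (hω : ω ^ 2 + ω + 1 = 0) (hd : IsAreaForm d) {u w : V} {c : F}
    {T : Finset V} (hT : T ∈ frameClass d ω u c) (hw : w ∈ T) :
    ∃ s : F, d (s • u) w = c ∧ T = zeroSumTriple ω (s • u) (w - s • u) := by
  -- it suffices to write `T` with `w` as the first of its three vectors
  have first : ∀ (s : F) (v : V), d (s • u) v = c → T = zeroSumTriple ω (s • u) v →
      w = s • u + v → ∃ s : F, d (s • u) w = c ∧ T = zeroSumTriple ω (s • u) (w - s • u) := by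
    rintro s v hc hT rfl
    refine ⟨s, ?_, by simpa using hT⟩
    simpa using (hd.sub_right (s • u) (s • u + v)).symm.trans (by simpa using hc)
  -- multiplying the Fourier coefficients by `ω` and `ω²` rotates the triple and keeps the area
  have rotate : ∀ (s : F) (v : V), d (s • u) v = c → T = zeroSumTriple ω (s • u) v →
      d ((ω * s) • u) (ω ^ 2 • v) = c ∧ T = zeroSumTriple ω ((ω * s) • u) (ω ^ 2 • v) := by
    intro s v hc hT
    rw [mul_smul]
    refine ⟨?_, by rw [zeroSumTriple_rotate hω, hT]⟩
    have := hd.comb ω 0 0 (ω ^ 2) (s • u) v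
    simp only [zero_smul, add_zero, zero_add] at this
    rw [this, hc]
    linear_combination (ω - 1) * c * hω
  obtain ⟨s, v, hc, rfl⟩ := hT
  obtain ⟨hc', hT'⟩ := rotate s v hc rfl
  obtain ⟨hc'', hT''⟩ := rotate _ _ hc' hT'
  rcases (by simpa [zeroSumTriple] using hw : w = s • u + v ∨
      w = ω • s • u + ω ^ 2 • v ∨ w = ω ^ 2 • s • u + ω • v) with h | h | h
  · exact first _ _ hc rfl h
  · exact first _ _ hc' hT' (by rw [h, mul_smul])
  · refine first _ _ hc'' hT'' ?_
    have h4 : ω ^ 2 * ω ^ 2 = ω := by linear_combination (ω ^ 2 - ω) * hω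
    rw [h, smul_smul (ω ^ 2) (ω ^ 2), h4, smul_smul]
    congr 2
    ring

theorem area_ne_zero_of_mem (hω : ω ^ 2 + ω + 1 = 0) (hd : IsAreaForm d) {u w : V} {c : F}
    (hc : c ≠ 0) {T : Finset V} (hT : T ∈ frameClass d ω u c) (hw : w ∈ T) : d u w ≠ 0 := by
  obtain ⟨s, hs, -⟩ := exists_eq_zeroSumTriple_sub hω hd hT hw
  intro h0
  rw [hd.smul_left, h0, mul_zero] at hs
  exact hc hs.symm

/-- Each vector off the line through `u` lies in exactly one triple of a holey class at `u`: as `p`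
runs over the line, `d p w` takes each value once. -/
theorem existsUnique_mem_frameClass (hω : ω ^ 2 + ω + 1 = 0) (hd : IsAreaForm d) {u w : V} (c : F)
    (huw : d u w ≠ 0) : ∃! T, T ∈ frameClass d ω u c ∧ w ∈ T := by
  have hs : d ((c / d u w) • u) w = c := by rw [hd.smul_left, div_mul_cancel₀ _ huw]
  refine ⟨zeroSumTriple ω ((c / d u w) • u) (w - (c / d u w) • u),
    ⟨⟨_, _, by rw [hd.sub_right, hs], rfl⟩, by simp [zeroSumTriple]⟩, ?_⟩
  rintro T ⟨hT, hw⟩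
  obtain ⟨s, hsc, rfl⟩ := exists_eq_zeroSumTriple_sub hω hd hT hw
  rw [hd.smul_left] at hsc
  rw [eq_div_of_mul_eq huw hsc]

/-- The shape of a frame block, in terms of its vectors. -/
theorem exists_eq_of_mem_frameClass (hω : ω ^ 2 + ω + 1 = 0) (h3 : (3 : F) ≠ 0)
    (hd : IsAreaForm d) {u : V} {c : F} (hc : c ≠ 0) {T : Finset V}
    (hT : T ∈ frameClass d ω u c) :
    ∃ x y z : V, x + y + z = 0 ∧ d x y ≠ 0 ∧ d y z ≠ 0 ∧ d z x ≠ 0 ∧ T = {x, y, z} := by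
  obtain ⟨s, v, hdc, rfl⟩ := hT
  have h0 := omega_sq_sub_ne_zero hω h3
  rw [← hdc] at hc
  refine ⟨_, _, _, ?_, ?_, ?_, ?_, rfl⟩
  · have : (s • u + v) + (ω • s • u + ω ^ 2 • v) + (ω ^ 2 • s • u + ω • v)
        = (ω ^ 2 + ω + 1) • (s • u) + (ω ^ 2 + ω + 1) • v := by module
    rw [this, hω]
    simp
  · have := hd.comb 1 1 ω (ω ^ 2) (s • u) v
    rw [one_smul, one_smul] at this
    rw [this]
    exact mul_ne_zero (by simpa using h0) hc
  · rw [hd.comb]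
    refine mul_ne_zero ?_ hc
    rwa [show ω * ω - ω ^ 2 * ω ^ 2 = ω ^ 2 - ω by linear_combination (ω - ω ^ 2) * hω]
  · have := hd.comb (ω ^ 2) ω 1 1 (s • u) v
    rw [one_smul, one_smul] at this
    rw [this]
    exact mul_ne_zero (by simpa using h0) hc

theorem eq_of_mem_frameClass (hω : ω ^ 2 + ω + 1 = 0) (h3 : (3 : F) ≠ 0)
    (hd : IsAreaForm d) {u : V} {c : F} (hc : c ≠ 0) {T : Finset V}
    (hT : T ∈ frameClass d ω u c) {x y : V} (hx : x ∈ T) (hy : y ∈ T) (hxy : x ≠ y) :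
    d x y ≠ 0 ∧ T = {x, y, -x - y} := by
  obtain ⟨a, b, e, hsum, hab, hbe, hea, rfl⟩ := exists_eq_of_mem_frameClass hω h3 hd hc hT
  have hba : d b a ≠ 0 := by rw [hd.swap]; exact neg_ne_zero.2 hab
  have heb : d e b ≠ 0 := by rw [hd.swap]; exact neg_ne_zero.2 hbe
  have hae : d a e ≠ 0 := by rw [hd.swap]; exact neg_ne_zero.2 hea
  have h1 : e = -a - b := by rw [← sub_eq_zero, ← hsum]; abel
  have h2 : a = -b - e := by rw [← sub_eq_zero, ← hsum]; abel
  have h2' : b = -a - e := by rw [← sub_eq_zero, ← hsum]; abel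
  simp only [Finset.mem_insert, Finset.mem_singleton] at hx hy
  rcases hx with rfl | rfl | rfl <;> rcases hy with rfl | rfl | rfl <;>
    first
    | exact absurd rfl hxy
    | refine ⟨by assumption, ?_⟩
  · rw [← h1]
  · rw [← h2', Finset.pair_comm]
  · rw [show -x - y = e by rw [h1]; abel, Finset.insert_comm]
  · rw [← h2]
    ext; simp; tauto
  · rw [show -x - y = b by rw [h2']; abel]
    ext; simp; tauto
  · rw [show -x - y = a by rw [h2]; abel]
    ext; simp; tauto

theorem card_of_mem_frameClass (hω : ω ^ 2 + ω + 1 = 0) (h3 : (3 : F) ≠ 0)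
    (hd : IsAreaForm d) {u : V} {c : F} (hc : c ≠ 0) {T : Finset V}
    (hT : T ∈ frameClass d ω u c) : T.card = 3 := by
  obtain ⟨a, b, e, -, hab, hbe, hea, rfl⟩ := exists_eq_of_mem_frameClass hω h3 hd hc hT
  refine Finset.card_eq_three.2 ⟨a, b, e, ?_, ?_, ?_, rfl⟩ <;> rintro rfl
  · exact hab (hd.self _)
  · exact hea (hd.self _)
  · exact hbe (hd.self _)

theorem sum_of_mem_frameClass (hω : ω ^ 2 + ω + 1 = 0) (h3 : (3 : F) ≠ 0)
    (hd : IsAreaForm d) {u : V} {c : F} (hc : c ≠ 0) {T : Finset V}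
    (hT : T ∈ frameClass d ω u c) : ∑ w ∈ T, w = 0 := by
  obtain ⟨a, b, e, hsum, hab, hbe, hea, rfl⟩ := exists_eq_of_mem_frameClass hω h3 hd hc hT
  have hne1 : a ≠ b := by rintro rfl; exact hab (hd.self _)
  have hne2 : b ≠ e := by rintro rfl; exact hbe (hd.self _)
  have hne3 : a ≠ e := by rintro rfl; exact hea (hd.self _)
  rw [Finset.sum_insert (by simp [hne1, hne3]), Finset.sum_pair hne2, ← add_assoc, hsum]

/-- Two independent vectors are the values of a Fourier transform; exchanging the coefficients
changes the sign of the area. -/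
theorem exists_frameClass_of_area_ne_zero (hω : ω ^ 2 + ω + 1 = 0) (h3 : (3 : F) ≠ 0)
    (hh : IsNormalizer h) (hd : IsAreaForm d) {H : Set F} (hH : ∀ c : F, c ≠ 0 → c ∈ H ∨ -c ∈ H)
    {x y : V} (hxy : d x y ≠ 0) :
    ∃ (u : {u : V // h u = 1}) (c : H), ∃ T ∈ frameClass d ω u c, x ∈ T ∧ y ∈ T := by
  have h0 := omega_sq_sub_ne_zero hω h3
  obtain ⟨k, hk⟩ : ∃ k : F, k * (ω ^ 2 - ω) = 1 := ⟨_, inv_mul_cancel₀ h0⟩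
  have hk0 : k ≠ 0 := left_ne_zero_of_mul_eq_one hk
  set p : V := (k * ω ^ 2) • x + (-k) • y with hp
  set v : V := (-(k * ω)) • x + k • y with hv
  have hpv : d p v ≠ 0 := by
    rw [hp, hv, hd.comb]
    refine mul_ne_zero ?_ hxy
    rw [show k * ω ^ 2 * k - -k * -(k * ω) = k * (k * (ω ^ 2 - ω)) by ring, hk, mul_one]
    exact hk0
  have hx : x = p + v := by
    have : p + v = (k * (ω ^ 2 - ω)) • x := by rw [hp, hv]; module
    rw [this, hk, one_smul]
  have hy : y = ω • p + ω ^ 2 • v := by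
    have : ω • p + ω ^ 2 • v = (k * (ω ^ 2 - ω)) • y := by rw [hp, hv]; module
    rw [this, hk, one_smul]
  have hxT : x ∈ zeroSumTriple ω p v := by rw [hx]; simp [zeroSumTriple]
  have hyT : y ∈ zeroSumTriple ω p v := by rw [hy]; simp [zeroSumTriple]
  have hvp : d v p ≠ 0 := by rw [hd.swap]; exact neg_ne_zero.2 hpv
  rcases hH _ hpv with hm | hm
  · obtain ⟨u, hu⟩ := hh.exists_eq_smul (hd.ne_zero_left hpv)
    exact ⟨u, ⟨_, hm⟩, _, ⟨h p, v, by rw [← hu], by rw [← hu]⟩, hxT, hyT⟩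
  · obtain ⟨u, hu⟩ := hh.exists_eq_smul (hd.ne_zero_left hvp)
    refine ⟨u, ⟨_, hm⟩, _, ⟨h v, p, by rw [← hu, hd.swap], ?_⟩, hxT, hyT⟩
    rw [← hu, zeroSumTriple_swap]

/-- A triple determines its line and its area up to exchanging the two Fourier coefficients, which
negates the area. -/
theorem frameClass_inter (hω : ω ^ 2 + ω + 1 = 0) (h3 : (3 : F) ≠ 0)
    (hh : IsNormalizer h) (hd : IsAreaForm d) {u u' : {u : V // h u = 1}} {c c' : F} (hc : c ≠ 0)
    {T : Finset V} (hT : T ∈ frameClass d ω u c)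
    (hT' : T ∈ frameClass d ω u' c') : (u = u' ∧ c = c') ∨ c = -c' := by
  have h0 := omega_sq_sub_ne_zero hω h3
  obtain ⟨w, hw⟩ : T.Nonempty := Finset.card_pos.1 (by
    rw [card_of_mem_frameClass hω h3 hd hc hT]; norm_num)
  obtain ⟨s, hs, hTs⟩ := exists_eq_zeroSumTriple_sub hω hd hT hw
  obtain ⟨s', hs', hTs'⟩ := exists_eq_zeroSumTriple_sub hω hd hT' hw
  have hs0 : s ≠ 0 := by
    rintro rfl
    rw [hd.smul_left, zero_mul] at hs
    exact hc hs.symm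
  -- compare the second vector of the first representation with the second representation
  have hmem : ω • (s • u.1) + ω ^ 2 • (w - s • u.1) ∈
      zeroSumTriple ω (s' • u'.1) (w - s' • u'.1) := by
    rw [← hTs', hTs]; simp [zeroSumTriple]
  simp only [zeroSumTriple, Finset.mem_insert, Finset.mem_singleton] at hmem
  rcases hmem with hm | hm | hm
  · -- then `w` would be proportional to `p`
    exfalso
    have e1 : (ω ^ 2 - 1) • w = (ω ^ 2 - ω) • (s • u.1) := by
      rw [← sub_eq_zero] at hm ⊢
      rw [← hm]; module
    have e2 : (ω ^ 2 - ω) * d (s • u.1) w = 0 := by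
      rw [← hd.smul_left, ← e1, hd.smul_left, hd.self, mul_zero]
    rw [hs] at e2
    exact mul_ne_zero h0 hc e2
  · left
    have e1 : (ω ^ 2 - ω) • (s • u.1) = (ω ^ 2 - ω) • (s' • u'.1) := by
      rw [← sub_eq_zero] at hm ⊢
      rw [← neg_eq_zero, ← hm]; module
    have e2 := smul_right_injective V h0 e1
    refine ⟨(hh.smul_eq_smul e2).2 hs0, ?_⟩
    rw [← hs, ← hs', e2]
  · right
    have e1 : (ω ^ 2 - ω) • (s • u.1) = (ω ^ 2 - ω) • (w - s' • u'.1) := by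
      rw [← sub_eq_zero] at hm ⊢
      rw [← neg_eq_zero, ← hm]; module
    have e2 := smul_right_injective V h0 e1
    rw [← hs, ← hs', e2, hd.sub_left]

end Extension

/-! ### From a system on `F` to a system on `V` -/

section Extension

variable {F V : Type*} [Field F] [AddCommGroup V] [Module F V] {h : V → F} {d : V → V → F}
  {ω : F}

/-- The special block `{0, ∞, ∞'}`. -/
def specialBlock (G : Type*) [Zero G] [DecidableEq G] : Finset (G ⊕ Bool) :=
  {Sum.inl 0, Sum.inr false, Sum.inr true}

/-- The embedding of `F ∪ {∞, ∞'}` onto the line through the normalised vector `u`, together with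
the infinite points. -/
def lineEmb (hh : IsNormalizer h) (u : {u : V // h u = 1}) : F ⊕ Bool ↪ V ⊕ Bool :=
  ⟨Sum.map (· • u.1) id, Function.Injective.sumMap
    (fun _ _ hst => (hh.smul_eq_smul hst).1) Function.injective_id⟩

@[simp] theorem lineEmb_inl (hh : IsNormalizer h) (u : {u : V // h u = 1}) (t : F) :
    lineEmb hh u (Sum.inl t) = Sum.inl (t • u.1) := rfl

@[simp] theorem lineEmb_inr (hh : IsNormalizer h) (u : {u : V // h u = 1}) (c : Bool) :
    lineEmb hh u (Sum.inr c) = Sum.inr c := rfl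

theorem mem_specialBlock {G : Type*} [Zero G] [DecidableEq G] {p : G ⊕ Bool} :
    p ∈ specialBlock G ↔ p = Sum.inl 0 ∨ ∃ c, p = Sum.inr c := by
  simp only [specialBlock, Finset.mem_insert, Finset.mem_singleton, Bool.exists_bool]

theorem map_specialBlock [DecidableEq F] [DecidableEq V] (hh : IsNormalizer h)
    (u : {u : V // h u = 1}) : (specialBlock F).map (lineEmb hh u) = specialBlock V := by
  simp [specialBlock, Finset.map_insert]

/-- Different lines meet only in the origin and the infinite points. -/
theorem lineEmb_eq_lineEmb [DecidableEq F] (hh : IsNormalizer h)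
    {u u' : {u : V // h u = 1}} {p p' : F ⊕ Bool}
    (hp : lineEmb hh u p = lineEmb hh u' p') : p = p' ∧ (u = u' ∨ p ∈ specialBlock F) := by
  rcases p with s | c <;> rcases p' with s' | c'
  · obtain ⟨rfl, hs⟩ := hh.smul_eq_smul (Sum.inl_injective hp)
    refine ⟨rfl, ?_⟩
    by_cases h0 : s = 0
    · exact Or.inr (mem_specialBlock.2 (Or.inl (by rw [h0])))
    · exact Or.inl (hs h0)
  · simp at hp
  · simp at hp
  · simp only [lineEmb_inr, Sum.inr.injEq] at hp
    exact ⟨by rw [hp], Or.inr (mem_specialBlock.2 (Or.inr ⟨c, rfl⟩))⟩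

theorem exists_lineEmb_eq [Nontrivial V] (hh : IsNormalizer h) (p : V ⊕ Bool) :
    ∃ u q, lineEmb hh u q = p := by
  obtain ⟨w, hw⟩ := exists_ne (0 : V)
  obtain ⟨u, -⟩ := hh.exists_eq_smul hw
  rcases p with v | c
  · by_cases hv : v = 0
    · exact ⟨u, Sum.inl 0, by simp [hv]⟩
    · obtain ⟨u', hu'⟩ := hh.exists_eq_smul hv
      exact ⟨u', Sum.inl (h v), by rw [lineEmb_inl, ← hu']⟩
  · exact ⟨u, Sum.inr c, rfl⟩

theorem exists_lineEmb_eq_inl (hh : IsNormalizer h) (hd : IsAreaForm d) {u : {u : V // h u = 1}}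
    {w : V} (hw : d u w = 0) : ∃ q, lineEmb hh u q = Sum.inl w := by
  obtain ⟨t, rfl⟩ := hd.exists_smul hw (hh.ne_zero_of_eq_one u)
  exact ⟨Sum.inl t, rfl⟩

/-- Two points are on a common line, or they are independent vectors. -/
theorem exists_lineEmb_pair [DecidableEq F] [DecidableEq V] [Nontrivial V]
    (hh : IsNormalizer h) (hd : IsAreaForm d)
    (p p' : V ⊕ Bool) : (∃ u q q', lineEmb hh u q = p ∧ lineEmb hh u q' = p') ∨
      ∃ w w', p = Sum.inl w ∧ p' = Sum.inl w' ∧ d w w' ≠ 0 := by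
  have special : ∀ p' : V ⊕ Bool, p' ∈ specialBlock V → ∀ u, ∃ q', lineEmb hh u q' = p' := by
    intro p' hp' u
    rw [← map_specialBlock hh u, Finset.mem_map] at hp'
    exact ⟨hp'.choose, hp'.choose_spec.2⟩
  by_cases hp : p ∈ specialBlock V
  · obtain ⟨u, q', hq'⟩ := exists_lineEmb_eq hh p'
    obtain ⟨q, hq⟩ := special p hp u
    exact Or.inl ⟨u, q, q', hq, hq'⟩
  by_cases hp' : p' ∈ specialBlock V
  · obtain ⟨u, q, hq⟩ := exists_lineEmb_eq hh p
    obtain ⟨q', hq'⟩ := special p' hp' u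
    exact Or.inl ⟨u, q, q', hq, hq'⟩
  rw [mem_specialBlock] at hp hp'
  rcases p with w | c
  swap
  · exact absurd (Or.inr ⟨c, rfl⟩) hp
  rcases p' with w' | c'
  swap
  · exact absurd (Or.inr ⟨c', rfl⟩) hp'
  by_cases h0 : d w w' = 0
  · left
    have hw : w ≠ 0 := by rintro rfl; exact hp (Or.inl rfl)
    obtain ⟨u, hu⟩ := hh.exists_eq_smul hw
    obtain ⟨t, rfl⟩ := hd.exists_smul h0 hw
    refine ⟨u, Sum.inl (h w), Sum.inl (t * h w), ?_, ?_⟩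
    · rw [lineEmb_inl, ← hu]
    · rw [lineEmb_inl, mul_smul, ← hu]
  · exact Or.inr ⟨w, w', rfl, rfl, h0⟩

theorem area_eq_zero_of_lineEmb (hh : IsNormalizer h) (hd : IsAreaForm d)
    {u : {u : V // h u = 1}} {q q' : F ⊕ Bool} {w w' : V}
    (hq : lineEmb hh u q = Sum.inl w) (hq' : lineEmb hh u q' = Sum.inl w') : d w w' = 0 := by
  rcases q with s | c
  · rcases q' with s' | c'
    · rw [← Sum.inl_injective hq, ← Sum.inl_injective hq']
      exact hd.smul_smul s s' _
    · simp at hq'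
  · simp at hq

/-- The blocks of the extended system: copies of the classes `R j` on the lines through the origin,
each completed by a holey class of zero-sum triples off the line. The class `R none`, whose copies
share the block `{0, ∞, ∞'}`, needs no completion: its copies on all lines form one class. -/
def extendedClass [DecidableEq V] (hh : IsNormalizer h) (d : V → V → F) (ω : F) {H : Set F}
    (R : Option H → Set (Finset (F ⊕ Bool))) (i : Option ({u : V // h u = 1} × H)) :
    Set (Finset (V ⊕ Bool)) :=
  {b | (∃ u j, i = Option.map (Prod.mk u) j ∧ ∃ a ∈ R j, b = a.map (lineEmb hh u)) ∨
    ∃ u c, i = some (u, c) ∧ ∃ T ∈ frameClass d ω u c, b = T.map Function.Embedding.inl}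

/-- A block with two points in the special block is the special block. -/
theorem IsResolvedSTS.eq_specialBlock {ι G : Type*} [Zero G] [DecidableEq G]
    {R : ι → Set (Finset (G ⊕ Bool))} (hR : IsResolvedSTS R) {i j : ι}
    (hS : specialBlock G ∈ R i) {a : Finset (G ⊕ Bool)} (ha : a ∈ R j) {p q : G ⊕ Bool}
    (hp : p ∈ a) (hq : q ∈ a) (hpq : p ≠ q) (hp' : p ∈ specialBlock G)
    (hq' : q ∈ specialBlock G) : a = specialBlock G :=
  hR.block_unique hpq ha hS hp hq hp' hq'

theorem IsResolvedSTS.exists_inl_or_eq_specialBlock {ι G : Type*} [Zero G] [DecidableEq G]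
    {R : ι → Set (Finset (G ⊕ Bool))} (hR : IsResolvedSTS R) {i j : ι}
    (hS : specialBlock G ∈ R i) {a : Finset (G ⊕ Bool)} (ha : a ∈ R j) :
    (∃ s s', s ≠ s' ∧ Sum.inl s ∈ a ∧ Sum.inl s' ∈ a) ∨ a = specialBlock G := by
  have hinl : ∀ s s' : G, (Sum.inl s : G ⊕ Bool) ≠ Sum.inl s' → s ≠ s' :=
    fun s s' hne hss => hne (by rw [hss])
  have hinr : ∀ c : Bool, (Sum.inr c : G ⊕ Bool) ∈ specialBlock G :=
    fun c => mem_specialBlock.2 (Or.inr ⟨c, rfl⟩)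
  obtain ⟨x, y, z, hxy, hxz, hyz, rfl⟩ := Finset.card_eq_three.1 (hR.card_block ha)
  have hx : x ∈ ({x, y, z} : Finset (G ⊕ Bool)) := by simp
  have hy : y ∈ ({x, y, z} : Finset (G ⊕ Bool)) := by simp
  have hz : z ∈ ({x, y, z} : Finset (G ⊕ Bool)) := by simp
  rcases x with s | c <;> rcases y with s' | c'
  · exact Or.inl ⟨s, s', hinl _ _ hxy, hx, hy⟩
  · rcases z with s' | c
    · exact Or.inl ⟨s, s', hinl _ _ hxz, hx, hz⟩
    · exact Or.inr (hR.eq_specialBlock hS ha hy hz hyz (hinr _) (hinr _))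
  · rcases z with s | c'
    · exact Or.inl ⟨s', s, hinl _ _ hyz, hy, hz⟩
    · exact Or.inr (hR.eq_specialBlock hS ha hx hz hxz (hinr _) (hinr _))
  · exact Or.inr (hR.eq_specialBlock hS ha hx hy hxy (hinr _) (hinr _))

theorem card_of_mem_extendedClass [DecidableEq V] (hh : IsNormalizer h) (hd : IsAreaForm d)
    (hω : ω ^ 2 + ω + 1 = 0) (h3 : (3 : F) ≠ 0) {H : Set F} (hH0 : ∀ c ∈ H, c ≠ 0)
    {R : Option H → Set (Finset (F ⊕ Bool))} (hR : IsResolvedSTS R)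
    {i : Option ({u : V // h u = 1} × H)} {b : Finset (V ⊕ Bool)}
    (hb : b ∈ extendedClass hh d ω R i) : b.card = 3 := by
  rcases hb with ⟨u, j, -, a, ha, rfl⟩ | ⟨u, c, -, T, hT, rfl⟩
  · rw [Finset.card_map, hR.card_block ha]
  · rw [Finset.card_map, card_of_mem_frameClass hω h3 hd (hH0 c c.2) hT]

/-- A copy of a base block on a line shares at most one point with a zero-sum triple. -/
theorem not_mem_line_and_frameClass [DecidableEq V] (hh : IsNormalizer h) (hd : IsAreaForm d)
    (hω : ω ^ 2 + ω + 1 = 0) (h3 : (3 : F) ≠ 0) {H : Set F} (hH0 : ∀ c ∈ H, c ≠ 0)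
    {u u' : {u : V // h u = 1}} {a : Finset (F ⊕ Bool)} {c : H} {T : Finset V}
    (hT : T ∈ frameClass d ω u' c) {x y : V ⊕ Bool} (hxy : x ≠ y)
    (hx : x ∈ T.map Function.Embedding.inl) (hy : y ∈ T.map Function.Embedding.inl)
    (hx' : x ∈ a.map (lineEmb hh u)) (hy' : y ∈ a.map (lineEmb hh u)) : False := by
  obtain ⟨w, hw, rfl⟩ := Finset.mem_map.1 hx
  obtain ⟨w', hw', rfl⟩ := Finset.mem_map.1 hy
  obtain ⟨q, -, hq⟩ := Finset.mem_map.1 hx'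
  obtain ⟨q', -, hq'⟩ := Finset.mem_map.1 hy'
  exact (eq_of_mem_frameClass hω h3 hd (hH0 c c.2) hT hw hw' (fun hww => hxy (by rw [hww]))).1
    (area_eq_zero_of_lineEmb hh hd hq hq')

/-- Two copies of base blocks with two common points come from the same base block. -/
theorem eq_of_mem_line_of_mem_line [DecidableEq F] (hh : IsNormalizer h) {ι : Type*}
    {R : ι → Set (Finset (F ⊕ Bool))} (hR : IsResolvedSTS R) {i j j' : ι}
    (hS : specialBlock F ∈ R i) {u u' : {u : V // h u = 1}} {a a' : Finset (F ⊕ Bool)}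
    (ha : a ∈ R j) (ha' : a' ∈ R j') {x y : V ⊕ Bool} (hxy : x ≠ y)
    (hx : x ∈ a.map (lineEmb hh u)) (hy : y ∈ a.map (lineEmb hh u))
    (hx' : x ∈ a'.map (lineEmb hh u')) (hy' : y ∈ a'.map (lineEmb hh u')) :
    a = a' ∧ (u = u' ∨ a = specialBlock F) := by
  obtain ⟨p, hp, rfl⟩ := Finset.mem_map.1 hx
  obtain ⟨q, hq, rfl⟩ := Finset.mem_map.1 hy
  obtain ⟨p', hp', hpp⟩ := Finset.mem_map.1 hx'
  obtain ⟨q', hq', hqq⟩ := Finset.mem_map.1 hy'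
  have hpq : p ≠ q := fun hpq => hxy (by rw [hpq])
  obtain ⟨rfl, h1⟩ := lineEmb_eq_lineEmb hh hpp.symm
  obtain ⟨rfl, h2⟩ := lineEmb_eq_lineEmb hh hqq.symm
  refine ⟨hR.block_unique hpq ha ha' hp hq hp' hq', ?_⟩
  rcases h1 with h1 | h1
  · exact Or.inl h1
  rcases h2 with h2 | h2
  · exact Or.inl h2
  exact Or.inr (hR.eq_specialBlock hS ha hp hq hpq h1 h2)

/-- The extended classes form a resolved Steiner triple system. The set `H` contains one element of
each pair `{c, -c}` of nonzero scalars. -/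
theorem IsResolvedSTS.extend [DecidableEq F] [DecidableEq V] [Nontrivial V]
    (hh : IsNormalizer h) (hd : IsAreaForm d)
    (hω : ω ^ 2 + ω + 1 = 0) (h3 : (3 : F) ≠ 0) {H : Set F} (hH0 : ∀ c ∈ H, c ≠ 0)
    (hH : ∀ c : F, c ≠ 0 → c ∈ H ∨ -c ∈ H) (hHn : ∀ c ∈ H, -c ∉ H)
    {R : Option H → Set (Finset (F ⊕ Bool))} (hR : IsResolvedSTS R)
    (hS : specialBlock F ∈ R none) : IsResolvedSTS (extendedClass hh d ω R) := by
  refine { card_block := fun i b hb => card_of_mem_extendedClass hh hd hω h3 hH0 hR hb,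
           parallel := ?_, pair := ?_, disjoint := ?_ }
  · rintro (_ | ⟨u, c⟩) x
    · obtain ⟨u, p, rfl⟩ := exists_lineEmb_eq hh x
      obtain ⟨a, ⟨ha, hp⟩, hau⟩ := hR.parallel none p
      refine ⟨a.map (lineEmb hh u), ⟨Or.inl ⟨u, none, rfl, a, ha, rfl⟩,
        Finset.mem_map_of_mem _ hp⟩, ?_⟩
      rintro b ⟨⟨u', j, hj, a', ha', rfl⟩ | ⟨u', c, hc, -⟩, hb⟩
      swap
      · simp at hc
      obtain rfl : j = none := by simpa using hj.symm
      obtain ⟨p', hp', hpp⟩ := Finset.mem_map.1 hb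
      obtain ⟨rfl, huu⟩ := lineEmb_eq_lineEmb hh hpp
      obtain rfl := hau a' ⟨ha', hp'⟩
      rcases huu with rfl | hsp
      · rfl
      · rw [(hR.parallel none p').unique ⟨ha', hp'⟩ ⟨hS, hsp⟩, map_specialBlock,
          map_specialBlock]
    · by_cases hx : ∃ p, lineEmb hh u p = x
      · obtain ⟨p, rfl⟩ := hx
        obtain ⟨a, ⟨ha, hp⟩, hau⟩ := hR.parallel (some c) p
        refine ⟨a.map (lineEmb hh u), ⟨Or.inl ⟨u, some c, rfl, a, ha, rfl⟩,
          Finset.mem_map_of_mem _ hp⟩, ?_⟩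
        rintro b ⟨⟨u', j, hj, a', ha', rfl⟩ | ⟨u', c', hc, T, hT, rfl⟩, hb⟩
        · obtain ⟨c', rfl⟩ : ∃ c', j = some c' := by
            cases j with
            | none => simp at hj
            | some c' => exact ⟨c', rfl⟩
          simp only [Option.map_some, Option.some.injEq, Prod.mk.injEq] at hj
          obtain ⟨rfl, rfl⟩ := hj
          rw [Finset.mem_map'] at hb
          rw [hau a' ⟨ha', hb⟩]
        · simp only [Option.some.injEq, Prod.mk.injEq] at hc
          obtain ⟨rfl, rfl⟩ := hc
          obtain ⟨w, hw, hwp⟩ := Finset.mem_map.1 hb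
          have hu1 : lineEmb hh u (Sum.inl 1) = Sum.inl u.1 := by simp
          exact absurd (area_eq_zero_of_lineEmb hh hd hu1 hwp.symm)
            (area_ne_zero_of_mem hω hd (hH0 c c.2) hT hw)
      · obtain ⟨w, rfl⟩ : ∃ w, x = Sum.inl w := by
          rcases x with w | e
          · exact ⟨w, rfl⟩
          · exact absurd ⟨Sum.inr e, rfl⟩ hx
        have huw : d u w ≠ 0 := fun h0 => hx (exists_lineEmb_eq_inl hh hd h0)
        obtain ⟨T, ⟨hT, hw⟩, hTu⟩ := existsUnique_mem_frameClass hω hd c.1 huw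
        refine ⟨T.map Function.Embedding.inl, ⟨Or.inr ⟨u, c, rfl, T, hT, rfl⟩,
          Finset.mem_map_of_mem _ hw⟩, ?_⟩
        rintro b ⟨⟨u', j, hj, a', ha', rfl⟩ | ⟨u', c', hc, T', hT', rfl⟩, hb⟩
        · obtain ⟨c', rfl⟩ : ∃ c', j = some c' := by
            cases j with
            | none => simp at hj
            | some c' => exact ⟨c', rfl⟩
          simp only [Option.map_some, Option.some.injEq, Prod.mk.injEq] at hj
          obtain ⟨rfl, rfl⟩ := hj
          obtain ⟨p, -, hp⟩ := Finset.mem_map.1 hb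
          exact absurd ⟨p, hp⟩ hx
        · simp only [Option.some.injEq, Prod.mk.injEq] at hc
          obtain ⟨rfl, rfl⟩ := hc
          obtain ⟨w', hw', hww⟩ := Finset.mem_map.1 hb
          obtain rfl := Sum.inl_injective hww
          rw [hTu T' ⟨hT', hw'⟩]
  · intro x y hxy
    refine existsUnique_of_exists_of_unique ?_ ?_
    · rcases exists_lineEmb_pair hh hd x y with ⟨u, p, q, rfl, rfl⟩ | ⟨w, w', rfl, rfl, hww⟩
      · obtain ⟨a, ⟨⟨j, ha⟩, hp, hq⟩, -⟩ := hR.pair p q (fun hpq => hxy (by rw [hpq]))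
        exact ⟨a.map (lineEmb hh u), ⟨_, Or.inl ⟨u, j, rfl, a, ha, rfl⟩⟩,
          Finset.mem_map_of_mem _ hp, Finset.mem_map_of_mem _ hq⟩
      · obtain ⟨u, c, T, hT, hw, hw'⟩ :=
          exists_frameClass_of_area_ne_zero hω h3 hh hd hH hww
        exact ⟨T.map Function.Embedding.inl, ⟨_, Or.inr ⟨u, c, rfl, T, hT, rfl⟩⟩,
          Finset.mem_map_of_mem _ hw, Finset.mem_map_of_mem _ hw'⟩
    · rintro b b' ⟨⟨i, hb⟩, hx, hy⟩ ⟨⟨i', hb'⟩, hx', hy'⟩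
      rcases hb with ⟨u, j, -, a, ha, rfl⟩ | ⟨u, c, -, T, hT, rfl⟩ <;>
        rcases hb' with ⟨u', j', -, a', ha', rfl⟩ | ⟨u', c', -, T', hT', rfl⟩
      · obtain ⟨rfl, rfl | rfl⟩ := eq_of_mem_line_of_mem_line hh hR hS ha ha' hxy hx hy hx' hy'
        · rfl
        · rw [map_specialBlock, map_specialBlock]
      · exact (not_mem_line_and_frameClass hh hd hω h3 hH0 hT' hxy hx' hy' hx hy).elim
      · exact (not_mem_line_and_frameClass hh hd hω h3 hH0 hT hxy hx hy hx' hy').elim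
      · obtain ⟨w, hw, rfl⟩ := Finset.mem_map.1 hx
        obtain ⟨w', hw', rfl⟩ := Finset.mem_map.1 hy
        rw [Finset.mem_map'] at hx' hy'
        have hww : w ≠ w' := fun hww => hxy (by rw [hww])
        rw [(eq_of_mem_frameClass hω h3 hd (hH0 c c.2) hT hw hw' hww).2,
          (eq_of_mem_frameClass hω h3 hd (hH0 c' c'.2) hT' hx' hy' hww).2]
  · intro i i' b hb hb'
    obtain ⟨x, hx, y, hy, hxy⟩ := Finset.one_lt_card.1
      (show 1 < b.card by rw [card_of_mem_extendedClass hh hd hω h3 hH0 hR hb]; norm_num)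
    rcases hb with ⟨u, j, rfl, a, ha, rfl⟩ | ⟨u, c, rfl, T, hT, rfl⟩ <;>
      rcases hb' with ⟨u', j', rfl, a', ha', haa⟩ | ⟨u', c', rfl, T', hT', haa⟩
    · obtain ⟨rfl, h1⟩ := eq_of_mem_line_of_mem_line hh hR hS ha ha' hxy hx hy (haa ▸ hx) (haa ▸ hy)
      obtain rfl := hR.disjoint ha ha'
      rcases h1 with rfl | rfl
      · rfl
      · rw [← hR.disjoint hS ha]
        rfl
    · exact (not_mem_line_and_frameClass hh hd hω h3 hH0 hT' hxy (haa ▸ hx) (haa ▸ hy) hx hy).elim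
    · exact (not_mem_line_and_frameClass hh hd hω h3 hH0 hT hxy hx hy (haa ▸ hx) (haa ▸ hy)).elim
    · obtain rfl := Finset.map_injective _ haa
      rcases frameClass_inter hω h3 hh hd (hH0 c c.2) hT hT' with ⟨rfl, hcc⟩ | hcc
      · rw [Subtype.ext hcc]
      · exact absurd c.2 (by rw [hcc]; exact hHn c' c'.2)

/-- Translations preserve differences, which distinguish copies of base blocks from zero-sum
triples; along a line the base system is rigid, and the sum of the points shows that the zero-sum
triples are. -/
theorem IsRigidKTS.extend_rigid [DecidableEq F] [DecidableEq V]
    (hh : IsNormalizer h) (hd : IsAreaForm d)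
    (hω : ω ^ 2 + ω + 1 = 0) (h3 : (3 : F) ≠ 0) {H : Set F} (hH0 : ∀ c ∈ H, c ≠ 0)
    {R : Option H → Set (Finset (F ⊕ Bool))} (hR : IsRigidKTS R)
    (hS : specialBlock F ∈ R none) {i i' : Option ({u : V // h u = 1} × H)}
    {b b' : Finset (V ⊕ Bool)} {t : V} (hb : b ∈ extendedClass hh d ω R i)
    (hb' : b' ∈ extendedClass hh d ω R i') (hbt : ∀ p ∈ b, shift t p ∈ b') : t = 0 := by
  -- translated blocks have the same differences, which tell lines and triples apart
  have diff : ∀ {u : {u : V // h u = 1}} {a : Finset (F ⊕ Bool)} {w w' : V},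
      Sum.inl w ∈ a.map (lineEmb hh u) →
      Sum.inl w' ∈ a.map (lineEmb hh u) → ∃ s : F, w - w' = s • u.1 := by
    intro u a w w' hw hw'
    obtain ⟨p, -, hp⟩ := Finset.mem_map.1 hw
    obtain ⟨p', -, hp'⟩ := Finset.mem_map.1 hw'
    rcases p with s | c
    swap
    · simp at hp
    rcases p' with s' | c
    swap
    · simp at hp'
    refine ⟨s - s', ?_⟩
    rw [sub_smul, ← Sum.inl_injective hp, ← Sum.inl_injective hp']
  have frame_diff : ∀ {u : {u : V // h u = 1}} {c : H} {T : Finset V},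
      T ∈ frameClass d ω u c → ∃ x ∈ T, ∃ y ∈ T, ∃ z ∈ T,
        d (x - y) (x - z) ≠ 0 := by
    intro u c T hT
    obtain ⟨x, y, z, hsum, hxy, -, -, rfl⟩ :=
      exists_eq_of_mem_frameClass hω h3 hd (hH0 c c.2) hT
    refine ⟨x, by simp, y, by simp, z, by simp, ?_⟩
    have hz : z = -x - y := by rw [← sub_eq_zero, ← hsum]; abel
    have e1 : x - y = (1 : F) • x + (-1 : F) • y := by module
    have e2 : x - z = (2 : F) • x + (1 : F) • y := by rw [hz]; module
    rw [e1, e2, hd.comb]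
    refine mul_ne_zero ?_ hxy
    rwa [show (1 : F) * 1 - -1 * 2 = 3 by norm_num]
  -- a translation onto a block of the same size is onto, so it can be reversed
  have hbt' : ∀ p ∈ b', shift (-t) p ∈ b := by
    have himg : b.map (shift t).toEmbedding = b' := by
      refine Finset.eq_of_subset_of_card_le (fun p hp => ?_) ?_
      · obtain ⟨q, hq, rfl⟩ := Finset.mem_map.1 hp
        exact hbt q hq
      · rw [Finset.card_map, card_of_mem_extendedClass hh hd hω h3 hH0 hR.toIsResolvedSTS hb,
          card_of_mem_extendedClass hh hd hω h3 hH0 hR.toIsResolvedSTS hb']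
    intro p hp
    rw [← himg, Finset.mem_map_equiv] at hp
    rcases p with v | c
    · simpa [sub_eq_add_neg] using hp
    · simpa using hp
  have frame_line : ∀ {u : {u : V // h u = 1}} {a : Finset (F ⊕ Bool)} {u' : {u : V // h u = 1}}
      {c : H} {T : Finset V} {t : V},
      T ∈ frameClass d ω u' c →
      (∀ p ∈ T.map (Function.Embedding.inl : V ↪ V ⊕ Bool), shift t p ∈ a.map (lineEmb hh u)) →
      False := by
    intro u a u' c T t hT ht
    obtain ⟨x, hx, y, hy, z, hz, hne⟩ := frame_diff hT
    have mem : ∀ {w : V}, w ∈ T → Sum.inl (w + t) ∈ a.map (lineEmb hh u) := fun hw =>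
      ht _ (Finset.mem_map_of_mem _ hw)
    obtain ⟨s, hs⟩ := diff (mem hx) (mem hy)
    obtain ⟨s', hs'⟩ := diff (mem hx) (mem hz)
    rw [add_sub_add_right_eq_sub] at hs hs'
    rw [hs, hs', hd.smul_smul] at hne
    exact hne rfl
  rcases hb with ⟨u, j, -, a, ha, rfl⟩ | ⟨u, c, -, T, hT, rfl⟩ <;>
    rcases hb' with ⟨u', j', -, a', ha', rfl⟩ | ⟨u', c', -, T', hT', rfl⟩
  · rcases hR.exists_inl_or_eq_specialBlock hS ha with ⟨s, s', hss, hs, hs'⟩ | hs1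
    · -- two finite points fix the direction of the line, so the translation is along it
      have m1 : Sum.inl (s • u.1 + t) ∈ a'.map (lineEmb hh u') :=
        hbt _ (Finset.mem_map_of_mem _ hs)
      have m2 : Sum.inl (s' • u.1 + t) ∈ a'.map (lineEmb hh u') :=
        hbt _ (Finset.mem_map_of_mem _ hs')
      obtain ⟨r, hr⟩ := diff m1 m2
      rw [add_sub_add_right_eq_sub, ← sub_smul] at hr
      obtain ⟨-, huu⟩ := hh.smul_eq_smul hr
      obtain rfl := huu (sub_ne_zero.2 hss)
      obtain ⟨p, -, hp⟩ := Finset.mem_map.1 m1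
      rcases p with e | c
      swap
      · simp at hp
      have ht : t = (e - s) • u.1 := by
        rw [sub_smul, eq_sub_iff_add_eq, add_comm]
        exact (Sum.inl_injective hp).symm
      have hes : e - s = 0 := by
        refine hR.rigid ha ha' fun q hq => ?_
        have hq' := hbt _ (Finset.mem_map_of_mem (lineEmb hh u) hq)
        have hcomm : shift t (lineEmb hh u q) = lineEmb hh u (shift (e - s) q) := by
          rcases q with v | c
          · simp [ht, add_smul]
          · rfl
        rwa [hcomm, Finset.mem_map'] at hq'
      rw [ht, hes, zero_smul]
    · -- otherwise the two blocks are both `{0, ∞, ∞'}`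
      subst hs1
      rw [map_specialBlock] at hbt
      have hinr : ∀ c, Sum.inr c ∈ a' := by
        intro c
        have := hbt (Sum.inr c) (mem_specialBlock.2 (Or.inr ⟨c, rfl⟩))
        rwa [shift_inr, ← lineEmb_inr hh u', Finset.mem_map'] at this
      have hs2 : a' = specialBlock F := hR.eq_specialBlock hS ha' (hinr false) (hinr true)
        (by simp) (mem_specialBlock.2 (Or.inr ⟨_, rfl⟩)) (mem_specialBlock.2 (Or.inr ⟨_, rfl⟩))
      rw [hs2, map_specialBlock] at hbt
      have := mem_specialBlock.1 (hbt (Sum.inl 0) (mem_specialBlock.2 (Or.inl rfl)))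
      simpa using this
  · exact (frame_line hT' hbt').elim
  · exact (frame_line hT hbt).elim
  · -- zero-sum triples: the sums differ by `3 t`
    have hc1 := card_of_mem_frameClass hω h3 hd (hH0 c c.2) hT
    have hc2 := card_of_mem_frameClass hω h3 hd (hH0 c' c'.2) hT'
    have himg : T.map (Equiv.addRight t).toEmbedding = T' := by
      refine Finset.eq_of_subset_of_card_le (fun p hp => ?_) (by rw [Finset.card_map, hc1, hc2])
      obtain ⟨w, hw, rfl⟩ := Finset.mem_map.1 hp
      exact (Finset.mem_map' Function.Embedding.inl).1 (hbt _ (Finset.mem_map_of_mem _ hw))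
    have e1 := sum_of_mem_frameClass hω h3 hd (hH0 c c.2) hT
    have e2 := sum_of_mem_frameClass hω h3 hd (hH0 c' c'.2) hT'
    rw [← himg, Finset.sum_map] at e2
    simp only [Equiv.coe_toEmbedding, Equiv.coe_addRight] at e2
    rw [Finset.sum_add_distrib, e1, Finset.sum_const, hc1, zero_add] at e2
    have : (3 : F) • t = 0 := by rw [← e2]; module
    exact (smul_eq_zero.1 this).resolve_left h3

/-- A translation-rigid Kirkman triple system on `F ∪ {∞, ∞'}` gives one on `V ∪ {∞, ∞'}`. -/
theorem IsRigidKTS.extend [DecidableEq F] [DecidableEq V] [Nontrivial V]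
    (hh : IsNormalizer h) (hd : IsAreaForm d)
    (hω : ω ^ 2 + ω + 1 = 0) (h3 : (3 : F) ≠ 0) {H : Set F} (hH0 : ∀ c ∈ H, c ≠ 0)
    (hH : ∀ c : F, c ≠ 0 → c ∈ H ∨ -c ∈ H) (hHn : ∀ c ∈ H, -c ∉ H)
    {R : Option H → Set (Finset (F ⊕ Bool))} (hR : IsRigidKTS R)
    (hS : specialBlock F ∈ R none) : IsRigidKTS (extendedClass hh d ω R) :=
  { hR.toIsResolvedSTS.extend hh hd hω h3 hH0 hH hHn hS with
    rigid := fun _ _ _ _ _ hb hb' hbt => hR.extend_rigid hh hd hω h3 hH0 hS hb hb' hbt }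

end Extension

/-! ### Verification of explicit systems -/

/-- Duplicate-freeness of a list of natural numbers, testing and setting bits of the mask `m`. The
match on the new mask makes the kernel evaluate it at each step. -/
def noDupFrom : ℕ → List ℕ → Bool
  | _, [] => true
  | m, a :: l =>
    match m ||| 2 ^ a with
    | 0 => false
    | m' + 1 => !m.testBit a && noDupFrom (m' + 1) l

theorem noDupFrom_spec (l : List ℕ) : ∀ m, noDupFrom m l = true →
    l.Nodup ∧ ∀ a ∈ l, m.testBit a = false := by
  induction l with
  | nil => simp
  | cons a l ih =>
    intro m hm
    rw [noDupFrom] at hm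
    split at hm
    · simp at hm
    · rename_i m' hm'
      rw [Bool.and_eq_true, Bool.not_eq_true'] at hm
      obtain ⟨hl, hbit⟩ := ih _ hm.2
      rw [← Nat.succ_eq_add_one, ← hm'] at hbit
      simp only [Nat.testBit_or, Bool.or_eq_false_iff, Nat.testBit_two_pow] at hbit
      refine ⟨List.nodup_cons.2 ⟨fun ha => ?_, hl⟩, ?_⟩
      · simpa using (hbit a ha).2
      · rintro b (_ | ⟨_, hb⟩)
        · exact hm.1
        · exact (hbit b hb).1

/-- A flag `(i, x, y, z)` records that class `i` contains the block `{x, y, z}`. -/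
abbrev BlockFlag : Type := ℕ × ℕ × ℕ × ℕ

/-- Exchange the last two points of a flag. -/
def BlockFlag.swap (f : BlockFlag) : BlockFlag := (f.1, f.2.1, f.2.2.2, f.2.2.1)

/-- The flags of a list of classes, numbered from `i`, each block in its three cyclic orders. -/
def blockFlags : ℕ → List (List (ℕ × ℕ × ℕ)) → List BlockFlag
  | _, [] => []
  | i, P :: Ps => P.flatMap (fun b =>
      [(i, b.1, b.2.1, b.2.2), (i, b.2.1, b.2.2, b.1), (i, b.2.2, b.1, b.2.1)]) ++
        blockFlags (i + 1) Ps

theorem rotate_mem_blockFlags {i x y z : ℕ} {cls : List (List (ℕ × ℕ × ℕ))} :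
    ∀ {k : ℕ}, (i, x, y, z) ∈ blockFlags k cls → (i, y, z, x) ∈ blockFlags k cls := by
  induction cls with
  | nil => simp [blockFlags]
  | cons P Ps ih =>
    intro k h
    simp only [blockFlags, List.mem_append, List.mem_flatMap] at h ⊢
    rcases h with ⟨b, hb, h⟩ | h
    · refine Or.inl ⟨b, hb, ?_⟩
      simp only [List.mem_cons, Prod.mk.injEq, List.not_mem_nil, or_false] at h ⊢
      tauto
    · exact Or.inr (ih h)

/-- All six orders of each block, from its three cyclic orders. -/
def orderings (L : List BlockFlag) : List BlockFlag := L ++ L.map BlockFlag.swap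

/-- The test performed on a system with `k + 1` classes on the points `0, …, q + 1`, of which
`q` and `q + 1` are infinite; `sub` is subtraction on `0, …, q - 1`. The three lists without
duplicates say that a class meets a point once, that a pair of points is covered once, and that
blocks are not translates of each other. -/
def isRigidKTSCode (q k : ℕ) (sub : ℕ → ℕ → ℕ) (L : List BlockFlag) : Bool :=
  L.length.beq ((q + 2) * (k + 1)) &&
  L.all (fun f => f.1.blt (k + 1) && f.2.1.blt (q + 2) && !f.2.1.beq f.2.2.1) &&
  noDupFrom 0 (L.map fun f => f.1 * (q + 2) + f.2.1) &&
  noDupFrom 0 ((orderings L).map fun f => f.2.1 * (q + 2) + f.2.2.1) &&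
  noDupFrom 0 (((orderings L).filter fun f => f.2.1.blt q && f.2.2.1.blt q).map fun f =>
    sub f.2.2.1 f.2.1 * (q + 2) + bif f.2.2.2.blt q then sub f.2.2.2 f.2.1 else f.2.2.2)

/-- The blocks of class `i` in a list of flags, with points named by the code `p`. -/
def decodedClass {X : Type*} [DecidableEq X] (p : X → ℕ) (L : List BlockFlag) (i : ℕ) :
    Set (Finset X) :=
  {b | ∃ x y z, (i, p x, p y, p z) ∈ L ∧ b = {x, y, z}}

section Soundness

variable {X : Type*} [DecidableEq X] {p : X → ℕ} {L : List BlockFlag}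

theorem mem_orderings {i x y z : ℕ} :
    (i, x, y, z) ∈ orderings L ↔ (i, x, y, z) ∈ L ∨ (i, x, z, y) ∈ L := by
  simp only [orderings, List.mem_append, List.mem_map, BlockFlag.swap, Prod.mk.injEq,
    Prod.exists]
  constructor
  · rintro (h | ⟨_, _, _, _, h, rfl, rfl, rfl, rfl⟩)
    exacts [Or.inl h, Or.inr h]
  · rintro (h | h)
    exacts [Or.inl h, Or.inr ⟨_, _, _, _, h, rfl, rfl, rfl, rfl⟩]

/-- A point of a block can be listed first. -/
theorem exists_flag_of_mem
    (hrot : ∀ {i x y z : ℕ}, (i, x, y, z) ∈ L → (i, y, z, x) ∈ L) {i : ℕ} {b : Finset X} {x : X}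
    (hb : b ∈ decodedClass p L i) (hx : x ∈ b) :
    ∃ y z, (i, p x, p y, p z) ∈ L ∧ b = {x, y, z} := by
  obtain ⟨a, y, z, h, rfl⟩ := hb
  simp only [Finset.mem_insert, Finset.mem_singleton] at hx
  rcases hx with rfl | rfl | rfl
  · exact ⟨_, _, h, rfl⟩
  · refine ⟨z, a, hrot h, ?_⟩
    ext; simp; tauto
  · refine ⟨a, y, hrot (hrot h), ?_⟩
    ext; simp; tauto

/-- Two points of a block can be listed first, in either order. -/
theorem exists_ordering_of_mem
    (hrot : ∀ {i x y z : ℕ}, (i, x, y, z) ∈ L → (i, y, z, x) ∈ L) {i : ℕ} {b : Finset X} {x y : X}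
    (hb : b ∈ decodedClass p L i) (hx : x ∈ b) (hy : y ∈ b) (hxy : x ≠ y) :
    ∃ z, (i, p x, p y, p z) ∈ orderings L ∧ b = {x, y, z} := by
  obtain ⟨a, c, h, rfl⟩ := exists_flag_of_mem hrot hb hx
  simp only [Finset.mem_insert, Finset.mem_singleton] at hy
  rcases hy with rfl | rfl | rfl
  · exact absurd rfl hxy
  · exact ⟨c, mem_orderings.2 (Or.inl h), rfl⟩
  · refine ⟨a, mem_orderings.2 (Or.inr h), ?_⟩
    rw [Finset.pair_comm]

/-- A list whose images under `g` are distinct and lie in a set of the same size as the list meets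
every fibre. -/
theorem exists_mem_list_map_eq {α β : Type*} [DecidableEq β] {l : List α} {g : α → β}
    {S : Finset β} (hnd : (l.map g).Nodup) (hS : ∀ a ∈ l, g a ∈ S) (hcard : S.card = l.length)
    {s : β} (hs : s ∈ S) : ∃ a ∈ l, g a = s := by
  have hsub : (l.map g).toFinset ⊆ S := by
    intro x hx
    obtain ⟨a, ha, rfl⟩ := List.mem_map.1 (List.mem_toFinset.1 hx)
    exact hS a ha
  have heq := Finset.eq_of_subset_of_card_le hsub (by
    rw [List.toFinset_card_of_nodup hnd, List.length_map, hcard])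
  rw [← heq] at hs
  exact List.mem_map.1 (List.mem_toFinset.1 hs)

/-- Distinctness of the codes of class-point pairs and of ordered pairs of points, with a count of
the blocks, makes the decoded classes a resolved Steiner triple system. -/
theorem isResolvedSTS_decodedClass {N k : ℕ} (hN : N = 2 * k + 3)
    (hp : Function.Injective p) (hpN : ∀ m, m < N ↔ ∃ x, p x = m)
    (hrot : ∀ {i x y z : ℕ}, (i, x, y, z) ∈ L → (i, y, z, x) ∈ L)
    (hlen : L.length = N * (k + 1))
    (hall : ∀ f ∈ L, f.1 < k + 1 ∧ f.2.1 < N ∧ f.2.1 ≠ f.2.2.1)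
    (hnd : (L.map fun f => f.1 * N + f.2.1).Nodup)
    (hnd' : ((orderings L).map fun f => f.2.1 * N + f.2.2.1).Nodup) :
    IsResolvedSTS fun i : Fin (k + 1) => decodedClass p L i := by
  have hinj : ∀ {i x y z y' z' : ℕ}, (i, x, y, z) ∈ L → (i, x, y', z') ∈ L → y = y' ∧ z = z' := by
    intro i x y z y' z' h h'
    have := List.inj_on_of_nodup_map hnd h h' rfl
    simpa using this
  have hinj' : ∀ {i j x y z z' : ℕ}, (i, x, y, z) ∈ orderings L → (j, x, y, z') ∈ orderings L →
      i = j ∧ z = z' := by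
    intro i j x y z z' h h'
    have := List.inj_on_of_nodup_map hnd' h h' rfl
    simpa using this
  -- all entries of a flag are codes of points
  have hpt : ∀ {i x y z : ℕ}, (i, x, y, z) ∈ L →
      ∃ a b c, p a = x ∧ p b = y ∧ p c = z ∧ a ≠ b ∧ b ≠ c ∧ c ≠ a := by
    intro i x y z h
    have h1 := hall _ h
    have h2 := hall _ (hrot h)
    have h3 := hall _ (hrot (hrot h))
    obtain ⟨a, rfl⟩ := (hpN _).1 h1.2.1
    obtain ⟨b, rfl⟩ := (hpN _).1 h2.2.1
    obtain ⟨c, rfl⟩ := (hpN _).1 h3.2.1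
    exact ⟨a, b, c, rfl, rfl, rfl, fun e => h1.2.2 (by rw [e]), fun e => h2.2.2 (by rw [e]),
      fun e => h3.2.2 (by rw [e])⟩
  refine { card_block := ?_, parallel := ?_, pair := ?_, disjoint := ?_ }
  · rintro i _ ⟨x, y, z, h, rfl⟩
    obtain ⟨a, b, c, ha, hb, hc, hab, hbc, hca⟩ := hpt h
    obtain rfl := hp ha
    obtain rfl := hp hb
    obtain rfl := hp hc
    exact Finset.card_eq_three.2 ⟨_, _, _, hab, hca.symm, hbc, rfl⟩
  · intro i x
    refine existsUnique_of_exists_of_unique ?_ ?_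
    · obtain ⟨⟨i', x', y', z'⟩, hf, hfe⟩ := exists_mem_list_map_eq
        (g := fun f : BlockFlag => (f.1, f.2.1)) (S := Finset.range (k + 1) ×ˢ Finset.range N)
        (l := L) (s := (i.1, p x))
        (List.Nodup.of_map (fun c : ℕ × ℕ => c.1 * N + c.2) (by rwa [List.map_map]))
        (fun f hf => by simpa using ⟨Nat.lt_succ_iff.1 (hall f hf).1, (hall f hf).2.1⟩)
        (by rw [Finset.card_product, Finset.card_range, Finset.card_range, hlen, mul_comm])
        (by simpa using ⟨Nat.lt_succ_iff.1 i.2, (hpN _).2 ⟨x, rfl⟩⟩)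
      obtain ⟨rfl, rfl⟩ := Prod.mk.inj hfe
      obtain ⟨a, b, c, ha, rfl, rfl, -⟩ := hpt hf
      exact ⟨{x, b, c}, ⟨x, b, c, hf, rfl⟩, by simp⟩
    · rintro b b' ⟨hb, hx⟩ ⟨hb', hx'⟩
      obtain ⟨y, z, h, rfl⟩ := exists_flag_of_mem hrot hb hx
      obtain ⟨y', z', h', rfl⟩ := exists_flag_of_mem hrot hb' hx'
      obtain ⟨e1, e2⟩ := hinj h h'
      rw [hp e1, hp e2]
  · intro x y hxy
    refine existsUnique_of_exists_of_unique ?_ ?_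
    · obtain ⟨⟨i', x', y', z'⟩, hf, hfe⟩ := exists_mem_list_map_eq
        (g := fun f : BlockFlag => (f.2.1, f.2.2.1)) (S := (Finset.range N).offDiag)
        (l := orderings L) (s := (p x, p y))
        (List.Nodup.of_map (fun c : ℕ × ℕ => c.1 * N + c.2) (by rwa [List.map_map]))
        (by
          rintro ⟨i, a, b, c⟩ hf
          simp only [Finset.mem_offDiag, Finset.mem_range]
          rcases mem_orderings.1 hf with hf | hf
          · exact ⟨(hall _ hf).2.1, (hall _ (hrot hf)).2.1, (hall _ hf).2.2⟩
          · exact ⟨(hall _ hf).2.1, (hall _ (hrot (hrot hf))).2.1,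
              (hall _ (hrot (hrot hf))).2.2.symm⟩)
        (by
          rw [Finset.offDiag_card, Finset.card_range, orderings, List.length_append,
            List.length_map, hlen, hN, ← Nat.mul_sub_one]
          rw [show 2 * k + 3 - 1 = 2 * (k + 1) by omega]
          ring)
        (by
          simp only [Finset.mem_offDiag, Finset.mem_range]
          exact ⟨(hpN _).2 ⟨x, rfl⟩, (hpN _).2 ⟨y, rfl⟩, hp.ne hxy⟩)
      obtain ⟨rfl, rfl⟩ := Prod.mk.inj hfe
      rcases mem_orderings.1 hf with hf | hf
      · obtain ⟨a, b, c, -, -, rfl, -⟩ := hpt hf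
        exact ⟨{x, y, c}, ⟨⟨i', (hall _ hf).1⟩, x, y, c, hf, rfl⟩, by simp, by simp⟩
      · obtain ⟨a, b, c, -, rfl, -, -⟩ := hpt hf
        exact ⟨{x, b, y}, ⟨⟨i', (hall _ hf).1⟩, x, b, y, hf, rfl⟩, by simp, by simp⟩
    · rintro b b' ⟨⟨i, hb⟩, hx, hy⟩ ⟨⟨j, hb'⟩, hx', hy'⟩
      obtain ⟨z, h, rfl⟩ := exists_ordering_of_mem hrot hb hx hy hxy
      obtain ⟨z', h', rfl⟩ := exists_ordering_of_mem hrot hb' hx' hy' hxy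
      rw [hp (hinj' h h').2]
  · intro i j b hb hb'
    obtain ⟨x, y, z, h, rfl⟩ := id hb
    have hxy : x ≠ y := fun e => (hall _ h).2.2 (by rw [e])
    obtain ⟨z', h', -⟩ := exists_ordering_of_mem hrot hb' (x := x) (y := y) (by simp) (by simp) hxy
    exact Fin.ext (hinj' (mem_orderings.2 (Or.inl h)) h').1

end Soundness

/-- The code of a point of `G ∪ {∞, ∞'}`, extending a code `c` of `G` by `0, …, q - 1`. -/
def pointCode {G : Type*} (q : ℕ) (c : G → ℕ) : G ⊕ Bool → ℕ :=
  Sum.elim c fun e => bif e then q + 1 else q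

section Soundness

variable {G : Type*} {q k : ℕ} {c : G → ℕ}

theorem pointCode_injective (hc : Function.Injective c) (hlt : ∀ x, c x < q) :
    Function.Injective (pointCode q c) := by
  rintro (x | _ | _) (y | _ | _) h
  all_goals
    have hl := hlt
    simp only [pointCode, Sum.elim_inl, Sum.elim_inr, cond_true, cond_false] at h
  · rw [hc h]
  · specialize hl x; omega
  · specialize hl x; omega
  · specialize hl y; omega
  · rfl
  · omega
  · specialize hl y; omega
  · omega
  · rfl

theorem lt_iff_exists_pointCode [Fintype G] (hG : Fintype.card G = q)
    (hc : Function.Injective c) (hlt : ∀ x, c x < q) (m : ℕ) :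
    m < q + 2 ↔ ∃ x, pointCode q c x = m := by
  classical
  have himg : Finset.univ.image (pointCode q c) = Finset.range (q + 2) := by
    refine Finset.eq_of_subset_of_card_le ?_ ?_
    · intro m hm
      obtain ⟨x, -, rfl⟩ := Finset.mem_image.1 hm
      rw [Finset.mem_range]
      rcases x with x | _ | _
      · exact (hlt x).trans (by omega)
      · simp [pointCode]
      · simp [pointCode]
    · rw [Finset.card_image_of_injective _ (pointCode_injective hc hlt)]
      simp [hG]
  rw [← Finset.mem_range, ← himg]
  simp

/-- Soundness of `isRigidKTSCode`. The hypothesis on `sub` is all that is needed of the subtraction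
of codes: it is invariant under translations. -/
theorem isRigidKTS_of_code [AddCommGroup G] [Fintype G] [DecidableEq G]
    (hG : Fintype.card G = q) (hqk : q = 2 * k + 1) (hc : Function.Injective c)
    (hlt : ∀ x, c x < q) (hc0 : c 0 = 0) {sub : ℕ → ℕ → ℕ}
    (hsub : ∀ x y t, sub (c (x + t)) (c (y + t)) = sub (c x) (c y))
    {P : List (ℕ × ℕ × ℕ)} {Ps : List (List (ℕ × ℕ × ℕ))}
    (hcode : isRigidKTSCode q k sub (blockFlags 0 (((0, q, q + 1) :: P) :: Ps)) = true) :
    ∃ R : Fin (k + 1) → Set (Finset (G ⊕ Bool)), IsRigidKTS R ∧ specialBlock G ∈ R 0 := by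
  set L := blockFlags 0 (((0, q, q + 1) :: P) :: Ps) with hL
  have hrot : ∀ {i x y z : ℕ}, (i, x, y, z) ∈ L → (i, y, z, x) ∈ L := rotate_mem_blockFlags
  simp only [isRigidKTSCode, Bool.and_eq_true, List.all_eq_true,
    Bool.not_eq_true'] at hcode
  obtain ⟨⟨⟨⟨hlen, hall⟩, hnd⟩, hnd'⟩, hnd''⟩ := hcode
  have hinj := pointCode_injective hc hlt
  have hR : IsResolvedSTS fun i : Fin (k + 1) => decodedClass (pointCode q c) L i := by
    refine isResolvedSTS_decodedClass (N := q + 2) (by omega) hinj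
      (lt_iff_exists_pointCode hG hc hlt) hrot (Nat.eq_of_beq_eq_true hlen) (fun f hf => ?_)
      (noDupFrom_spec _ _ hnd).1 (noDupFrom_spec _ _ hnd').1
    obtain ⟨⟨h1, h2⟩, h3⟩ := hall f hf
    refine ⟨?_, ?_, ?_⟩
    · simpa [Nat.blt_eq] using h1
    · simpa [Nat.blt_eq] using h2
    · intro h
      rw [h, Nat.beq_refl] at h3
      exact absurd h3 (by simp)
  have hS : specialBlock G ∈ decodedClass (pointCode q c) L 0 :=
    ⟨Sum.inl 0, Sum.inr false, Sum.inr true, by simp [hL, blockFlags, pointCode, hc0], rfl⟩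
  refine ⟨_, { hR with rigid := ?_ }, hS⟩
  intro i j b b' t hb hb' hbt
  rcases hR.exists_inl_or_eq_specialBlock (i := 0) hS hb with ⟨s, s', hss, hs, hs'⟩ | rfl
  · -- the differences from the first two points are unchanged by the translation
    obtain ⟨z, h, hbz⟩ := exists_ordering_of_mem hrot hb hs hs' (by simpa using hss)
    obtain ⟨z', h', hbz'⟩ := exists_ordering_of_mem hrot hb' (hbt _ hs) (hbt _ hs')
      (by simpa using hss)
    have hz : shift t z = z' := by
      have hcard := hR.card_block hb
      have hzb : z ∈ b := by rw [hbz]; simp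
      have hzs : z ≠ Sum.inl s := by
        rintro rfl
        rw [hbz] at hcard
        have := Finset.card_le_two (a := (Sum.inl s' : G ⊕ Bool)) (b := Sum.inl s)
        rw [Finset.insert_eq_of_mem (by simp)] at hcard
        omega
      have hzs' : z ≠ Sum.inl s' := by
        rintro rfl
        rw [hbz, Finset.pair_eq_singleton] at hcard
        have := Finset.card_le_two (a := (Sum.inl s : G ⊕ Bool)) (b := Sum.inl s')
        omega
      have := hbt z hzb
      rw [hbz'] at this
      simp only [Finset.mem_insert, Finset.mem_singleton, (shift t).injective.eq_iff] at this
      exact (this.resolve_left hzs).resolve_left hzs'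
    subst hz
    have hcode := List.inj_on_of_nodup_map (noDupFrom_spec _ _ hnd'').1
      (List.mem_filter.2 ⟨h, by simp [pointCode, Nat.blt_eq, hlt]⟩)
      (List.mem_filter.2 ⟨h', by simp [pointCode, Nat.blt_eq, hlt]⟩) (by
        rcases z with r | e
        · have h1 : (c r).blt q = true := by simp [Nat.blt_eq, hlt]
          have h2 : (c (r + t)).blt q = true := by simp [Nat.blt_eq, hlt]
          simp [pointCode, hsub, h1, h2]
        · have h1 : ∀ e : Bool, (bif e then q + 1 else q).blt q = false := by
            intro e
            rw [Bool.eq_false_iff, Ne, Nat.blt_eq]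
            cases e <;> simp
          simp [pointCode, hsub, h1])
    have hst : Sum.inl s = shift t (Sum.inl s) := hinj (by simpa using congrArg (·.2.1) hcode)
    simpa using hst
  · have hinr : ∀ e, Sum.inr e ∈ b' := fun e => by
      simpa using hbt (Sum.inr e) (mem_specialBlock.2 (Or.inr ⟨e, rfl⟩))
    have hb's : b' = specialBlock G := hR.eq_specialBlock (i := 0) hS hb' (hinr false) (hinr true)
      (by simp) (mem_specialBlock.2 (Or.inr ⟨_, rfl⟩)) (mem_specialBlock.2 (Or.inr ⟨_, rfl⟩))
    rw [hb's] at hbt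
    simpa using mem_specialBlock.1 (hbt (Sum.inl 0) (mem_specialBlock.2 (Or.inl rfl)))

end Soundness

/-! ### Powers of the order of a field -/

/-- In odd characteristic the nonzero elements split into two halves exchanged by negation. -/
theorem exists_half (F : Type*) [Field F] [Fintype F] {k : ℕ} (hF : Fintype.card F = 2 * k + 1)
    (h2 : (2 : F) ≠ 0) : ∃ H : Set F, (∀ c : F, c ≠ 0 → c ∈ H ∨ -c ∈ H) ∧ (∀ c ∈ H, c ≠ 0) ∧
      (∀ c ∈ H, -c ∉ H) ∧ Nonempty (H ≃ Fin k) := by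
  classical
  let e := Fintype.equivFin F
  let H : Finset F := Finset.univ.filter fun c => e c < e (-c)
  have hmem : ∀ c, c ∈ H ↔ e c < e (-c) := by simp [H]
  have hne : ∀ c : F, c ≠ 0 → e c ≠ e (-c) := by
    intro c hc hcc
    have h := e.injective hcc
    have : 2 * c = 0 := by linear_combination h
    exact (mul_ne_zero h2 hc) this
  have h1 : ∀ c : F, c ≠ 0 → c ∈ H ∨ -c ∈ H := by
    intro c hc
    rw [hmem, hmem, neg_neg]
    exact lt_or_gt_of_ne (hne c hc)
  have h3 : ∀ c ∈ H, c ≠ 0 := by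
    rintro c hc rfl
    rw [hmem, neg_zero] at hc
    exact lt_irrefl _ hc
  have h4 : ∀ c ∈ H, -c ∉ H := by
    intro c hc hc'
    rw [hmem] at hc hc'
    rw [neg_neg] at hc'
    exact lt_asymm hc hc'
  refine ⟨H, fun c hc => by simpa using h1 c hc, fun c hc => h3 c (by simpa using hc),
    fun c hc => by simpa using h4 c (by simpa using hc), ?_⟩
  have hunion : (Finset.univ : Finset F).erase 0 = H ∪ H.map (Equiv.neg F).toEmbedding := by
    ext c
    simp only [Finset.mem_erase, Finset.mem_univ, and_true, Finset.mem_union, Finset.mem_map_equiv,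
      Equiv.neg_symm, Equiv.neg_apply]
    exact ⟨h1 c, fun h => h.elim (h3 c) fun h => neg_ne_zero.1 (h3 _ h)⟩
  have hdisj : Disjoint H (H.map (Equiv.neg F).toEmbedding) := by
    rw [Finset.disjoint_left]
    intro c hc hc'
    rw [Finset.mem_map_equiv, Equiv.neg_symm, Equiv.neg_apply] at hc'
    exact h4 c hc hc'
  have hcard := congrArg Finset.card hunion
  rw [Finset.card_union_of_disjoint hdisj, Finset.card_map, Finset.card_erase_of_mem
    (Finset.mem_univ _), Finset.card_univ, hF] at hcard
  refine ⟨(Fintype.equivFinOfCardEq ?_)⟩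
  simp only [Finset.coe_sort_coe, Fintype.card_coe]
  omega

theorem exists_primitive_cube_root (F : Type*) [Field F] [Fintype F] {m : ℕ}
    (hF : Fintype.card F = 3 * m + 1) : ∃ ω : F, ω ^ 2 + ω + 1 = 0 := by
  classical
  have : Fact (Nat.Prime 3) := ⟨Nat.prime_three⟩
  obtain ⟨x, hx⟩ := exists_prime_orderOf_dvd_card (G := Fˣ) 3
    (by rw [Fintype.card_units, hF]; exact ⟨m, by omega⟩)
  refine ⟨x, ?_⟩
  have h3 : ((x : F) - 1) * ((x : F) ^ 2 + x + 1) = 0 := by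
    have : (x : F) ^ 3 = 1 := by
      rw [← Units.val_pow_eq_pow_val, ← hx, pow_orderOf_eq_one, Units.val_one]
    linear_combination this
  refine (mul_eq_zero.1 h3).resolve_left fun h => ?_
  have h1 : x = 1 := Units.ext (by simpa using sub_eq_zero.1 h)
  rw [h1, orderOf_one] at hx
  norm_num at hx

/-- A translation-rigid Kirkman triple system over a field of order `q = 6 m + 1` gives large sets
of order `q ^ n + 2` for all `n ≥ 1`. -/
theorem existsLKTS_card_pow {F : Type} [Field F] [Fintype F] [DecidableEq F] {m : ℕ}
    (hF : Fintype.card F = 6 * m + 1) {R : Fin (3 * m + 1) → Set (Finset (F ⊕ Bool))}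
    (hR : IsRigidKTS R) (hS : specialBlock F ∈ R 0) {n : ℕ} (hn : 1 ≤ n) :
    ExistsLKTS (Fintype.card F ^ n + 2) := by
  have hcast : ((6 * m + 1 : ℕ) : F) = 0 := by rw [← hF, FiniteField.cast_card_eq_zero]
  push_cast at hcast
  have h2 : (2 : F) ≠ 0 := fun h => one_ne_zero (α := F) (by linear_combination hcast - 3 * m * h)
  have h3 : (3 : F) ≠ 0 := fun h => one_ne_zero (α := F) (by linear_combination hcast - 2 * m * h)
  obtain ⟨ω, hω⟩ := exists_primitive_cube_root F (m := 2 * m) (by omega)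
  obtain ⟨H, hH, hH0, hHn, ⟨e⟩⟩ := exists_half F (k := 3 * m) (by omega) h2
  obtain ⟨h, hh⟩ := exists_isNormalizer F (Fin n)
  obtain ⟨d, hd⟩ := exists_isAreaForm F (Fin n)
  have : Nonempty (Fin n) := ⟨⟨0, hn⟩⟩
  let f : Option H ≃ Fin (3 * m + 1) := (Equiv.optionCongr e).trans (finSuccEquiv _).symm
  have hf : f none = 0 := by simp [f]
  have hext := (hR.reindex f).extend hh hd hω h3 hH0 hH hHn
    (by rw [Function.comp_apply, hf]; exact hS)
  have := hext.existsLKTS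
  rwa [Fintype.card_fun, Fintype.card_fin] at this

/-! ### The initial systems -/

theorem ZMod.val_add_sub_val_mod {q : ℕ} [NeZero q] (x y : ZMod q) :
    (x.val + (q - y.val)) % q = (x - y).val := by
  rw [← ZMod.val_natCast, Nat.cast_add, Nat.cast_sub (ZMod.val_lt y).le]
  simp [sub_eq_add_neg]

/-- A verified list of classes on `ZMod q`, with `{0, ∞, ∞'}` in the first class, gives large sets
of order `q ^ n + 2`. -/
theorem existsLKTS_zmod {q m : ℕ} [Fact q.Prime] (hq : q = 6 * m + 1) {P : List (ℕ × ℕ × ℕ)}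
    {Ps : List (List (ℕ × ℕ × ℕ))}
    (hcode : isRigidKTSCode q (3 * m) (fun i j => (i + (q - j)) % q)
      (blockFlags 0 (((0, q, q + 1) :: P) :: Ps)) = true) {n : ℕ} (hn : 1 ≤ n) :
    ExistsLKTS (q ^ n + 2) := by
  obtain ⟨R, hR, hS⟩ := isRigidKTS_of_code (ZMod.card q) (by omega) (ZMod.val_injective q)
    ZMod.val_lt ZMod.val_zero (fun x y t => by
      rw [ZMod.val_add_sub_val_mod, ZMod.val_add_sub_val_mod, add_sub_add_right_eq_sub]) hcode
  have := existsLKTS_card_pow ((ZMod.card q).trans hq) hR hS hn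
  rwa [ZMod.card] at this

/-! For `q = 7, 31, 37, 43, 61` the system is invariant under a group of multipliers of odd order
divisible by `3`. The class of `{0, ∞, ∞'}` consists of the cosets of the group of cube roots of
unity, and the other classes are the multiples of one or two base classes. For `q = 13, 19, 25` all
classes are listed. -/

/-- Multiply the finite points of a block by `m` modulo `q`. -/
def mulTriple (q m : ℕ) (b : ℕ × ℕ × ℕ) : ℕ × ℕ × ℕ :=
  let f : ℕ → ℕ := fun x => bif x.blt q then m * x % q else x
  (f b.1, f b.2.1, f b.2.2)

/-- The multiples of the classes in `Ps` by the members of `M`. -/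
def mulClasses (q : ℕ) (M : List ℕ) (Ps : List (List (ℕ × ℕ × ℕ))) :
    List (List (ℕ × ℕ × ℕ)) :=
  M.flatMap fun m => Ps.map (List.map (mulTriple q m))

theorem existsLKTS_seven_pow {n : ℕ} (hn : 1 ≤ n) : ExistsLKTS (7 ^ n + 2) := by
  have : Fact (Nat.Prime 7) := ⟨by norm_num⟩
  exact existsLKTS_zmod (q := 7) (m := 1) rfl
    (P :=
      [(1, 2, 4), (3, 5, 6)])
    (Ps := mulClasses 7
      [1, 2, 4]
      [[(0, 1, 6), (2, 3, 7), (4, 5, 8)]])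
    (by decide +kernel) hn

theorem existsLKTS_thirteen_pow {n : ℕ} (hn : 1 ≤ n) : ExistsLKTS (13 ^ n + 2) := by
  have : Fact (Nat.Prime 13) := ⟨by norm_num⟩
  exact existsLKTS_zmod (q := 13) (m := 2) rfl
    (P :=
      [(1, 10, 12), (2, 7, 9), (3, 5, 8), (4, 6, 11)])
    (Ps :=
      [[(0, 10, 11), (1, 6, 9), (2, 8, 12), (3, 4, 13), (5, 7, 14)],
       [(0, 7, 8), (1, 3, 11), (2, 4, 5), (6, 10, 14), (9, 12, 13)],
       [(0, 1, 5), (2, 11, 13), (3, 6, 7), (4, 12, 14), (8, 9, 10)],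
       [(0, 2, 6), (1, 4, 8), (3, 9, 14), (5, 10, 13), (7, 11, 12)],
       [(0, 4, 9), (1, 7, 13), (2, 3, 10), (5, 6, 12), (8, 11, 14)],
       [(0, 3, 12), (1, 2, 14), (4, 7, 10), (5, 9, 11), (6, 8, 13)]])
    (by decide +kernel) hn

theorem existsLKTS_nineteen_pow {n : ℕ} (hn : 1 ≤ n) : ExistsLKTS (19 ^ n + 2) := by
  have : Fact (Nat.Prime 19) := ⟨by norm_num⟩
  exact existsLKTS_zmod (q := 19) (m := 3) rfl
    (P :=
      [(1, 7, 11), (2, 3, 14), (4, 6, 9), (5, 16, 17), (8, 12, 18), (10, 13, 15)])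
    (Ps :=
      [[(0, 12, 17), (1, 9, 19), (2, 8, 11), (3, 6, 10), (4, 15, 18), (5, 13, 14), (7, 16, 20)],
       [(0, 16, 18), (1, 5, 20), (2, 10, 17), (3, 7, 12), (4, 11, 19), (6, 8, 13), (9, 14, 15)],
       [(0, 7, 13), (1, 8, 15), (2, 9, 20), (3, 17, 18), (4, 5, 10), (6, 11, 16), (12, 14, 19)],
       [(0, 4, 14), (1, 6, 12), (2, 7, 15), (3, 5, 11), (8, 9, 17), (10, 16, 19), (13, 18, 20)],
       [(0, 11, 15), (1, 4, 17), (2, 5, 12), (3, 8, 19), (6, 14, 20), (7, 10, 18), (9, 13, 16)],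
       [(0, 1, 10), (2, 18, 19), (3, 4, 20), (5, 7, 9), (6, 15, 17), (8, 14, 16), (11, 12, 13)],
       [(0, 2, 6), (1, 3, 13), (4, 12, 16), (5, 15, 19), (7, 14, 17), (8, 10, 20), (9, 11, 18)],
       [(0, 3, 9), (1, 2, 16), (4, 7, 8), (5, 6, 18), (10, 11, 14), (12, 15, 20), (13, 17, 19)],
       [(0, 5, 8), (1, 14, 18), (2, 4, 13), (3, 15, 16), (6, 7, 19), (9, 10, 12), (11, 17, 20)]])
    (by decide +kernel) hn

theorem existsLKTS_thirtyOne_pow {n : ℕ} (hn : 1 ≤ n) : ExistsLKTS (31 ^ n + 2) := by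
  have : Fact (Nat.Prime 31) := ⟨by norm_num⟩
  exact existsLKTS_zmod (q := 31) (m := 5) rfl
    (P :=
      [(1, 5, 25), (2, 10, 19), (3, 13, 15), (4, 7, 20), (6, 26, 30), (8, 9, 14), (11, 24, 27),
       (12, 21, 29), (16, 18, 28), (17, 22, 23)])
    (Ps := mulClasses 31
      [1, 7, 18, 2, 14, 5, 4, 28, 10, 8, 25, 20, 16, 19, 9]
      [[(0, 14, 17), (1, 9, 12), (2, 23, 30), (3, 16, 26), (4, 10, 13), (5, 18, 19), (6, 27, 29),
        (7, 21, 28), (8, 11, 15), (20, 24, 31), (22, 25, 32)]])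
    (by decide +kernel) hn

theorem existsLKTS_thirtySeven_pow {n : ℕ} (hn : 1 ≤ n) : ExistsLKTS (37 ^ n + 2) := by
  have : Fact (Nat.Prime 37) := ⟨by norm_num⟩
  exact existsLKTS_zmod (q := 37) (m := 6) rfl
    (P :=
      [(1, 10, 26), (2, 15, 20), (3, 4, 30), (5, 13, 19), (6, 8, 23), (7, 33, 34), (9, 12, 16),
       (11, 27, 36), (14, 29, 31), (17, 22, 35), (18, 24, 32), (21, 25, 28)])
    (Ps := mulClasses 37
      [1, 7, 12, 10, 33, 9, 26, 34, 16]
      [[(0, 20, 27), (1, 8, 32), (2, 12, 30), (3, 33, 37), (4, 17, 28), (5, 7, 14), (6, 18, 22),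
        (9, 26, 31), (10, 34, 36), (11, 13, 25), (15, 19, 24), (16, 35, 38), (21, 23, 29)],
       [(0, 10, 35), (1, 20, 30), (2, 21, 24), (3, 18, 29), (4, 32, 38), (5, 16, 23), (6, 11, 17),
        (7, 15, 22), (8, 9, 36), (12, 19, 25), (13, 31, 37), (14, 26, 33), (27, 28, 34)]])
    (by decide +kernel) hn

theorem existsLKTS_fortyThree_pow {n : ℕ} (hn : 1 ≤ n) : ExistsLKTS (43 ^ n + 2) := by
  have : Fact (Nat.Prime 43) := ⟨by norm_num⟩
  exact existsLKTS_zmod (q := 43) (m := 7) rfl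
    (P :=
      [(1, 6, 36), (2, 12, 29), (3, 18, 22), (4, 15, 24), (5, 8, 30), (7, 37, 42), (9, 11, 23),
       (10, 16, 17), (13, 35, 38), (14, 31, 41), (19, 28, 39), (20, 32, 34), (21, 25, 40),
       (26, 27, 33)])
    (Ps := mulClasses 43
      [1, 9, 38, 41, 25, 10, 4, 36, 23, 35, 14, 40, 16, 15, 6, 11, 13, 31, 21, 17, 24]
      [[(0, 15, 34), (1, 5, 37), (2, 4, 23), (3, 31, 32), (6, 17, 22), (7, 24, 33), (8, 12, 19),
        (9, 39, 43), (10, 11, 35), (13, 20, 44), (14, 29, 36), (16, 40, 41), (18, 21, 26),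
        (25, 30, 42), (27, 28, 38)]])
    (by decide +kernel) hn

theorem existsLKTS_sixtyOne_pow {n : ℕ} (hn : 1 ≤ n) : ExistsLKTS (61 ^ n + 2) := by
  have : Fact (Nat.Prime 61) := ⟨by norm_num⟩
  exact existsLKTS_zmod (q := 61) (m := 10) rfl
    (P :=
      [(1, 13, 47), (2, 26, 33), (3, 19, 39), (4, 5, 52), (6, 17, 38), (7, 24, 30), (8, 10, 43),
       (9, 56, 57), (11, 21, 29), (12, 15, 34), (14, 48, 60), (16, 20, 25), (18, 51, 53),
       (22, 42, 58), (23, 44, 55), (27, 46, 49), (28, 35, 59), (31, 37, 54), (32, 40, 50),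
       (36, 41, 45)])
    (Ps := mulClasses 61
      [1, 12, 22, 20, 57, 13, 34, 42, 16, 9, 47, 15, 58, 25, 56]
      [[(0, 12, 31), (1, 29, 59), (2, 47, 55), (3, 42, 61), (4, 26, 60), (5, 34, 50), (6, 43, 48),
        (7, 10, 46), (8, 21, 53), (9, 25, 37), (11, 22, 45), (13, 16, 51), (14, 40, 56),
        (15, 30, 35), (17, 19, 33), (18, 39, 44), (20, 41, 62), (23, 24, 57), (27, 32, 58),
        (28, 36, 54), (38, 49, 52)],
       [(0, 4, 44), (1, 9, 14), (2, 35, 41), (3, 7, 25), (5, 42, 48), (6, 28, 46), (8, 50, 62),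
        (10, 16, 40), (11, 39, 56), (12, 21, 22), (13, 17, 58), (15, 18, 33), (19, 30, 47),
        (20, 37, 38), (23, 29, 61), (24, 31, 51), (26, 43, 52), (27, 55, 59), (32, 53, 54),
        (34, 45, 57), (36, 49, 60)]])
    (by decide +kernel) hn

/-- The additive group of the field of order `25` is identified with `ZMod 5 × ZMod 5`, and `(a, b)`
is encoded as `5 a + b`. -/
theorem existsLKTS_twentyFive_pow {n : ℕ} (hn : 1 ≤ n) : ExistsLKTS (25 ^ n + 2) := by
  classical
  have : Fact (Nat.Prime 5) := ⟨Nat.prime_five⟩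
  have hcard : Nat.card (GaloisField 5 2) = 25 := GaloisField.card 5 2 two_ne_zero
  have : Fintype (GaloisField 5 2) := Fintype.ofFinite _
  rw [Nat.card_eq_fintype_card] at hcard
  let e : GaloisField 5 2 ≃ₗ[ZMod 5] ZMod 5 × ZMod 5 := LinearEquiv.ofFinrankEq _ _ (by
    rw [GaloisField.finrank 5 two_ne_zero, Module.finrank_prod, Module.finrank_self])
  let c : GaloisField 5 2 → ℕ := fun x => 5 * (e x).1.val + (e x).2.val
  have hlt : ∀ x : ZMod 5, x.val < 5 := ZMod.val_lt
  have hdiv : ∀ x, c x / 5 = (e x).1.val := fun x => by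
    have := hlt (e x).2
    simp only [c]; omega
  have hmod : ∀ x, c x % 5 = (e x).2.val := fun x => by
    have := hlt (e x).2
    simp only [c]; omega
  have hinj : Function.Injective c := fun x y hxy => by
    refine e.injective (Prod.ext (ZMod.val_injective 5 ?_) (ZMod.val_injective 5 ?_))
    · rw [← hdiv, ← hdiv, hxy]
    · rw [← hmod, ← hmod, hxy]
  obtain ⟨R, hR, hS⟩ := isRigidKTS_of_code (q := 25) (k := 12) (c := c)
    (sub := fun i j => (i / 5 + (5 - j / 5)) % 5 * 5 + (i % 5 + (5 - j % 5)) % 5)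
    hcard rfl hinj
    (fun x => by
      have h1 := hlt (e x).1
      have h2 := hlt (e x).2
      simp only [c]; omega)
    (by simp [c])
    (fun x y t => by
      simp only [hdiv, hmod, ZMod.val_add_sub_val_mod, map_add, Prod.fst_add, Prod.snd_add,
        add_sub_add_right_eq_sub])
    (P :=
      [(1, 12, 17), (2, 9, 24), (3, 6, 21), (4, 13, 18), (5, 11, 14), (7, 8, 15), (10, 22, 23),
       (16, 19, 20)])
    (Ps :=
      [[(0, 14, 16), (1, 8, 20), (2, 11, 12), (3, 18, 19), (4, 5, 22), (6, 7, 25), (9, 13, 15),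
        (10, 17, 21), (23, 24, 26)],
       [(0, 13, 17), (1, 15, 21), (2, 8, 19), (3, 11, 22), (4, 9, 10), (5, 12, 25), (6, 16, 23),
        (7, 14, 24), (18, 20, 26)],
       [(0, 10, 15), (1, 5, 26), (2, 16, 17), (3, 13, 14), (4, 20, 25), (6, 9, 19), (7, 18, 22),
        (8, 12, 23), (11, 21, 24)],
       [(0, 6, 24), (1, 2, 13), (3, 4, 17), (5, 8, 16), (7, 21, 26), (9, 23, 25), (10, 12, 19),
        (11, 15, 18), (14, 20, 22)],
       [(0, 11, 19), (1, 3, 23), (2, 4, 7), (5, 17, 24), (6, 13, 20), (8, 21, 25), (9, 22, 26),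
        (10, 14, 18), (12, 15, 16)],
       [(0, 1, 4), (2, 18, 23), (3, 7, 12), (5, 6, 10), (8, 9, 11), (13, 16, 26), (14, 17, 25),
        (15, 20, 24), (19, 21, 22)],
       [(0, 7, 23), (1, 19, 24), (2, 20, 21), (3, 5, 9), (4, 6, 11), (8, 10, 13), (12, 14, 26),
        (15, 17, 22), (16, 18, 25)],
       [(0, 9, 21), (1, 6, 18), (2, 22, 25), (3, 8, 26), (4, 12, 24), (5, 7, 13), (10, 11, 16),
        (14, 15, 19), (17, 20, 23)],
       [(0, 5, 20), (1, 9, 14), (2, 10, 26), (3, 15, 25), (4, 16, 21), (6, 12, 22), (7, 17, 19),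
        (8, 18, 24), (11, 13, 23)],
       [(0, 12, 18), (1, 11, 25), (2, 5, 15), (3, 10, 20), (4, 19, 26), (6, 8, 17), (7, 9, 16),
        (13, 22, 24), (14, 21, 23)],
       [(0, 8, 22), (1, 7, 10), (2, 6, 14), (3, 16, 24), (4, 15, 23), (5, 18, 21), (9, 12, 20),
        (11, 17, 26), (13, 19, 25)],
       [(0, 2, 3), (1, 16, 22), (4, 8, 14), (5, 19, 23), (6, 15, 26), (7, 11, 20), (9, 17, 18),
        (10, 24, 25), (12, 13, 21)]])
    (by decide +kernel)
  have := existsLKTS_card_pow (m := 4) hcard hR hS hn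
  rwa [hcard] at this

theorem mainTheorem2 (q : ℕ) (hq : q ∈ ({7, 13, 19, 25, 31, 37, 43, 49, 61} : Set ℕ))
    (n : ℕ) (hn : 1 ≤ n) : ExistsLKTS (q ^ n + 2) := by
  simp only [Set.mem_insert_iff, Set.mem_singleton_iff] at hq
  rcases hq with rfl | rfl | rfl | rfl | rfl | rfl | rfl | rfl | rfl
  · exact existsLKTS_seven_pow hn
  · exact existsLKTS_thirteen_pow hn
  · exact existsLKTS_nineteen_pow hn
  · exact existsLKTS_twentyFive_pow hn
  · exact existsLKTS_thirtyOne_pow hn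
  · exact existsLKTS_thirtySeven_pow hn
  · exact existsLKTS_fortyThree_pow hn
  · -- a power of `49` is an even power of `7`
    rw [show 49 = 7 ^ 2 by norm_num, ← pow_mul]
    exact existsLKTS_seven_pow (by omega)
  · exact existsLKTS_sixtyOne_pow hn
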